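/- Let $k$ be a field with the discrete topology, and let $\mathbf{Vect}_0(k)$ be the category of finite-dimensional $k$-vector spaces. Let $\Pi=\{(i,j)\in\mathbb Z^2: i\le j\}$ with the product order. A functor $V:\Pi\to\mathbf{Vect}_0(k)$ is *admissible* if $0\to V_{ij}\to V_{il}\to V_{jl}\to 0$ is exact for all $i\le j\le l$. The category of Tate spaces $\mathcal T=\underleftrightarrow{\lim}\,\mathbf{Vect}_0(k)$ is the localization of the category of admissible functors at the natural morphisms $(V_{\varphi_0(i),\varphi_0(j)})\to (V_{\varphi_1(i),\varphi_1(j)})$, where $\varphi_0\le\varphi_1$ are nondecreasing maps $\mathbb Z\to\mathbb Z$ tending to $\pm\infty$ at $\pm\infty$. A linearly topologized $k$-vector space is a Hausdorff topological $k$-vector space in which the open linear subspaces form a basis of neighbourhoods of $0$. It is *linearly compact* if every family of closed affine subspaces with the finite intersection property has a common point, and *locally linearly compact* if it has an open linearly compact subspace. A locally linearly compact space is *of countable type* if $0$ has a countable neighbourhood basis and the space is a union of countably many open linearly compact subspaces. Morphisms of such spaces are the continuous linear maps. Limits and colimits below are taken in topological $k$-vector spaces, finite-dimensional spaces being discrete.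 Then: 1. $(V_{ij})\mapsto \varinjlim_{j\to\infty}\varprojlim_{i\to-\infty}V_{ij}$ induces an equivalence $\Phi$ from $\mathcal T$ to the category of locally linearly compact topological $k$-vector spaces of countable type. 2. The projective limit $``\varprojlim"V_j\mapsto\varprojlim V_j$ induces an equivalence $\Phi_0$ from the category $\mathrm{Pro}^s(\mathbf{Vect}_0(k))$ of strict pro-objects (those represented by a system, indexed by an arbitrary small filtered category, with epimorphic structure morphisms) to the category of linearly compact topological $k$-vector spaces. 3. Let $\mathrm{Pro}^s_{\aleph_0}(\mathbf{Vect}_0(k))\subset \mathrm{Pro}^s(\mathbf{Vect}_0(k))$ be the full subcategory of the strict pro-objects represented by such systems indexed by countable filtered categories. There is a fully faithful functor $E:\mathrm{Pro}^s_{\aleph_0}(\mathbf{Vect}_0(k))\to\mathcal T$ which sends $``\varprojlim"_{i\le 0}V_{i,0}$ to $(V_{ij})$, naturally in $(V_{ij})$, for every admissible $(V_{ij})$ such that $V_{i,0}\to V_{i,j}$ is an isomorphism for all $i\le 0\le j$; the restriction $\Phi\circ E$ of $\Phi$ is isomorphic to the restriction of $\Phi_0$, and its essential image consists of the linearly compact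 spaces of countable type. -/

import Mathlib

open CategoryTheory Limits Opposite Topology

universe v u

/-! ### Pro-objects -/

section ProObjects

variable (C : Type u) [Category.{v} C]

/-- The category of pro-objects of `C`, i.e. `Pro(C) = Ind(Cᵒᵖ)ᵒᵖ`. -/
abbrev ProObj : Type (max u (v + 1)) := (Ind Cᵒᵖ)ᵒᵖ

/-- The embedding `C ⥤ Pro(C)` (constant pro-objects). -/
noncomputable def ProObj.const : C ⥤ ProObj C :=
  opOp C ⋙ (Ind.yoneda (C := Cᵒᵖ)).op

/-- The functor `F ↦ "lim" F_j` from projective systems indexed by a small filtered category `J`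
to pro-objects. -/
noncomputable def ProObj.lim (J : Type v) [SmallCategory J] [IsFiltered J] :
    (Jᵒᵖ ⥤ C) ⥤ ProObj C :=
  (Functor.leftOpRightOpEquiv J C).functor.rightOp ⋙ (Ind.lim J).op

variable {C} in
/-- The canonical cone from the pro-object `"lim" F_j` to the constant pro-objects `F_j`. -/
noncomputable def ProObj.cone {J : Type v} [SmallCategory J] [IsFiltered J] (F : Jᵒᵖ ⥤ C) :
    Cone (F ⋙ ProObj.const C) where
  pt := (ProObj.lim C J).obj F
  π := (colimit.cocone (F.rightOp ⋙ Ind.yoneda)).op.π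

/-- Strict pro-objects: those isomorphic to some `"lim" F_j`, with `J` a small filtered category,
whose structure morphisms are epimorphisms. -/
def IsStrictPro : ObjectProperty (ProObj C) := fun X =>
  ∃ (J : Type v) (_ : SmallCategory J) (_ : IsFiltered J) (F : Jᵒᵖ ⥤ C),
    (∀ (a b : Jᵒᵖ) (f : a ⟶ b), Epi (F.map f)) ∧ Nonempty (X ≅ (ProObj.lim C J).obj F)

/-- Countable strict pro-objects: those isomorphic to some `"lim" F_j`, with `J` a countable
filtered category, whose structure morphisms are epimorphisms. -/
def IsCountableStrictPro : ObjectProperty (ProObj C) := fun X =>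
  ∃ (J : Type v) (_ : SmallCategory J) (_ : IsFiltered J) (_ : CountableCategory J)
    (F : Jᵒᵖ ⥤ C),
    (∀ (a b : Jᵒᵖ) (f : a ⟶ b), Epi (F.map f)) ∧ Nonempty (X ≅ (ProObj.lim C J).obj F)

theorem isCountableStrictPro_le : IsCountableStrictPro C ≤ IsStrictPro C := by
  rintro X ⟨J, i₁, i₂, _, F, hF, e⟩
  exact ⟨J, i₁, i₂, F, hF, e⟩

end ProObjects

/-! ### The Beilinson category -/

section Beilinson

/-- The ordered set `Π = {(i, j) ∈ ℤ × ℤ | i ≤ j}`, with the order induced from `ℤ × ℤ`. -/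
abbrev TateIdx : Type := {p : ℤ × ℤ // p.1 ≤ p.2}

/-- The element `(i, j)` of `Π`. -/
abbrev TateIdx.mk (i j : ℤ) (h : i ≤ j) : TateIdx := ⟨(i, j), h⟩

/-- The morphism `(i, j) ⟶ (i', j')` of `Π` for `i ≤ i'` and `j ≤ j'`. -/
noncomputable def TateIdx.hom {i j i' j' : ℤ} (h : i ≤ j) (h' : i' ≤ j') (hi : i ≤ i') (hj : j ≤ j') :
    TateIdx.mk i j h ⟶ TateIdx.mk i' j' h' :=
  homOfLE (show TateIdx.mk i j h ≤ TateIdx.mk i' j' h' from ⟨hi, hj⟩)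

variable (A : Type u) [Category.{v} A] [HasZeroMorphisms A]

/-- A functor `X : Π ⥤ A` is admissible if `0 → X_{ij} → X_{ik} → X_{jk} → 0` is a short exact
sequence for all `i ≤ j ≤ k`. -/
def IsAdmissibleBiFun : ObjectProperty (TateIdx ⥤ A) := fun X =>
  ∀ (i j k : ℤ) (hij : i ≤ j) (hjk : j ≤ k),
    ∃ w : X.map (TateIdx.hom hij (hij.trans hjk) le_rfl hjk) ≫
        X.map (TateIdx.hom (hij.trans hjk) hjk hij le_rfl) = 0,
      (ShortComplex.mk _ _ w).ShortExact

/-- The category of admissible functors `Π ⥤ A`. -/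
abbrev AdmBiFun := (IsAdmissibleBiFun A).FullSubcategory

/-- A nondecreasing map `φ : ℤ → ℤ` is bicofinal if `φ → ±∞` at `±∞`. -/
structure Bicofinal extends ℤ →o ℤ where
  tendsto_atBot : Filter.Tendsto toFun Filter.atBot Filter.atBot
  tendsto_atTop : Filter.Tendsto toFun Filter.atTop Filter.atTop

/-- The endofunctor `(i, j) ↦ (φ i, φ j)` of `Π`. -/
noncomputable def Bicofinal.tilde (φ : Bicofinal) : TateIdx ⥤ TateIdx :=
  Monotone.functor (f := fun p => TateIdx.mk (φ.toFun p.1.1) (φ.toFun p.1.2) (φ.monotone' p.2))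
    (fun _ _ h => ⟨φ.monotone' h.1, φ.monotone' h.2⟩)

variable {A}

/-- The admissible functor `X ∘ φ̃`, i.e. `(i, j) ↦ X_{φ i, φ j}`. -/
noncomputable def AdmBiFun.reindex (X : AdmBiFun A) (φ : Bicofinal) : AdmBiFun A :=
  ⟨φ.tilde ⋙ X.obj, fun i j k hij hjk =>
    X.property (φ.toFun i) (φ.toFun j) (φ.toFun k) (φ.monotone' hij) (φ.monotone' hjk)⟩

/-- For `φ₀ ≤ φ₁`, the morphism `X ∘ φ̃₀ ⟶ X ∘ φ̃₁` given by the structure morphisms of `X`. -/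
noncomputable def AdmBiFun.reindexHom (X : AdmBiFun A) {φ₀ φ₁ : Bicofinal}
    (h : ∀ n, φ₀.toFun n ≤ φ₁.toFun n) : X.reindex φ₀ ⟶ X.reindex φ₁ :=
  ObjectProperty.homMk
    { app := fun p => X.obj.map (TateIdx.hom (φ₀.monotone' p.2) (φ₁.monotone' p.2)
        (h p.1.1) (h p.1.2))
      naturality := fun p _ f =>
        (X.obj.map_comp _ _).symm.trans
          (X.obj.map_comp (TateIdx.hom (φ₀.monotone' p.2) (φ₁.monotone' p.2)
            (h p.1.1) (h p.1.2)) (φ₁.tilde.map f)) }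

variable (A)

/-- The class `U_a` of the morphisms `X ∘ φ̃₀ ⟶ X ∘ φ̃₁`, for `X` an admissible functor and
`φ₀ ≤ φ₁` bicofinal. -/
inductive BeilinsonU : ∀ ⦃X Y : AdmBiFun A⦄, (X ⟶ Y) → Prop
  | mk (X : AdmBiFun A) (φ₀ φ₁ : Bicofinal) (h : ∀ n, φ₀.toFun n ≤ φ₁.toFun n) :
      BeilinsonU (X.reindexHom h)

/-- `U_a` as a class of morphisms in the sense of localization theory. -/
def beilinsonU : MorphismProperty (AdmBiFun A) := fun _ _ f => BeilinsonU A f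

/-- The Beilinson category `lim↔ A`: the localization of the category of admissible functors
`Π ⥤ A` at `U_a`. -/
abbrev BeilinsonCat := (beilinsonU A).Localization

/-- An admissible functor `X` is constant in the ind-direction if `X_{i,0} → X_{i,j}` is an
isomorphism for all `i ≤ 0 ≤ j`. -/
def IsIndConstant : ObjectProperty (AdmBiFun A) := fun X =>
  ∀ (i j : ℤ) (hi : i ≤ 0) (hj : 0 ≤ j),
    IsIso (X.obj.map (TateIdx.hom hi (hi.trans hj) le_rfl hj))

/-- The functor `n ↦ (-n, 0)` from `ℕᵒᵖ` to `Π` (with `ℕ` lifted to the universe of the index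
categories of pro-objects). -/
noncomputable def negIdx : (ULift.{v} ℕ)ᵒᵖ ⥤ TateIdx where
  obj n := TateIdx.mk (-(n.unop.down : ℤ)) 0 (by simp)
  map f := TateIdx.hom _ _ (neg_le_neg (Int.ofNat_le.mpr (ULift.down_le.mpr (leOfHom f.unop))))
    le_rfl

/-- The functor sending an admissible functor `X` that is constant in the ind-direction to the
countable strict pro-object `"lim"_{i ≤ 0} X_{i,0}`. -/
noncomputable def indConstantToPro :
    (IsIndConstant A).FullSubcategory ⥤ (IsCountableStrictPro A).FullSubcategory :=
  ObjectProperty.lift _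
    ((IsIndConstant A).ι ⋙ (IsAdmissibleBiFun A).ι ⋙
      (Functor.whiskeringLeft _ _ A).obj negIdx.{v} ⋙ ProObj.lim A (ULift.{v} ℕ))
    (fun X => ⟨ULift.{v} ℕ, inferInstance, inferInstance, inferInstance,
      negIdx.{v} ⋙ X.obj.obj, fun a b f => by
        obtain ⟨w, hw⟩ := X.obj.property (-(a.unop.down : ℤ)) (-(b.unop.down : ℤ)) 0
          (neg_le_neg (Int.ofNat_le.mpr (ULift.down_le.mpr (leOfHom f.unop)))) (by simp)
        exact hw.epi_g,
      ⟨Iso.refl _⟩⟩)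

end Beilinson

/-! ### Linearly compact and locally linearly compact spaces -/

section LinearTopology

variable (k V : Type*) [Field k] [AddCommGroup V] [Module k V] [TopologicalSpace V]

/-- `V` is a (Hausdorff) linearly topologized space in which every family of closed affine
subspaces with the finite intersection property has a common point. -/
structure IsLinearlyCompact : Prop where
  t2 : T2Space V
  linear : IsLinearTopology k V
  inter_nonempty : ∀ 𝓕 : Set (AffineSubspace k V), (∀ L ∈ 𝓕, IsClosed (L : Set V)) →
    (∀ 𝓖 : Finset (AffineSubspace k V), (𝓖 : Set (AffineSubspace k V)) ⊆ 𝓕 →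
      (⋂ L ∈ 𝓖, (L : Set V)).Nonempty) →
    (⋂ L ∈ 𝓕, (L : Set V)).Nonempty

/-- `V` is a (Hausdorff) linearly topologized space with a linearly compact open subspace. -/
structure IsLocallyLinearlyCompact : Prop where
  t2 : T2Space V
  linear : IsLinearTopology k V
  exists_open : ∃ U : Submodule k V, IsOpen (U : Set V) ∧ IsLinearlyCompact k U

/-- `V` is of countable type: `0` has a countable neighbourhood basis, and `V` is a union of
countably many linearly compact open subspaces. -/
structure IsOfCountableType : Prop where
  countable_nhds : (𝓝 (0 : V)).IsCountablyGenerated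
  exists_cover : ∃ U : ℕ → Submodule k V,
    (∀ n, IsOpen (U n : Set V) ∧ IsLinearlyCompact k (U n)) ∧ ∀ x : V, ∃ n, x ∈ U n

end LinearTopology

section Spaces

variable (k : Type u) [Field k] [TopologicalSpace k]

/-- Linearly compact topological `k`-vector spaces. -/
def linearlyCompactProp : ObjectProperty (TopModuleCat.{u} k) := fun V => IsLinearlyCompact k V

/-- Locally linearly compact topological `k`-vector spaces of countable type. -/
def countableLLCProp : ObjectProperty (TopModuleCat.{u} k) := fun V =>
  IsLocallyLinearlyCompact k V ∧ IsOfCountableType k V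

/-- The category `𝓛₀` of linearly compact spaces and continuous linear maps. -/
abbrev LinearlyCompactCat := (linearlyCompactProp k).FullSubcategory

/-- The category of locally linearly compact spaces of countable type and continuous linear
maps. -/
abbrev CountableLLCCat := (countableLLCProp k).FullSubcategory

variable [DiscreteTopology k]

/-- A finite-dimensional vector space, equipped with the discrete topology. -/
def discreteFunctor : FGModuleCat.{u} k ⥤ TopModuleCat.{u} k where
  obj V :=
    letI : TopologicalSpace V := ⊥
    haveI : DiscreteTopology V := ⟨rfl⟩
    haveI : ContinuousSMul k V := ⟨continuous_of_discreteTopology⟩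
    TopModuleCat.of k V
  map {V W} f :=
    letI : TopologicalSpace V := ⊥
    haveI : DiscreteTopology V := ⟨rfl⟩
    letI : TopologicalSpace W := ⊥
    haveI : DiscreteTopology W := ⟨rfl⟩
    haveI : ContinuousSMul k V := ⟨continuous_of_discreteTopology⟩
    haveI : ContinuousSMul k W := ⟨continuous_of_discreteTopology⟩
    TopModuleCat.ofHom ⟨f.hom.hom, continuous_of_discreteTopology⟩

/-- `Λ : Pro(Vect₀(k)) ⥤ TopModuleCat k` is the projective limit functor
`"lim" F_j ↦ lim F_j`, where finite-dimensional spaces are discrete: there is an isomorphism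
`β` between its restriction to `Vect₀(k)` and `discreteFunctor k`, and for each projective system
`F` the projections `Λ("lim" F_j) ⟶ Λ(F_j) ≅ F_j` exhibit `Λ("lim" F_j)` as the limit of the
topological vector spaces `F_j`. -/
def IsProjectiveLimitFunctor (Λ : ProObj (FGModuleCat.{u} k) ⥤ TopModuleCat.{u} k) : Prop :=
  ∃ β : ProObj.const (FGModuleCat.{u} k) ⋙ Λ ≅ discreteFunctor k,
    ∀ (J : Type u) [SmallCategory J] [IsFiltered J] (F : Jᵒᵖ ⥤ FGModuleCat.{u} k),
      Nonempty (IsLimit ((Cone.postcompose (Functor.whiskerLeft F β.hom)).obj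
        (Λ.mapCone (ProObj.cone F))))

/-- The functor `j ↦ (i ↦ (min i j, j))`. A functor `X` on `Π` is extended along it to a functor
on `ℤ × ℤ`, by `X_{i,j} = X_{j,j}` for `i > j`. -/
noncomputable def extendIdx : ℤ ⥤ ℤ ⥤ TateIdx where
  obj j := Monotone.functor (f := fun i => TateIdx.mk (min i j) j (min_le_right i j))
    (fun _ _ h => ⟨min_le_min_right j h, le_rfl⟩)
  map {j j'} h :=
    { app := fun i => TateIdx.hom _ _ (min_le_min_left i (leOfHom h)) (leOfHom h) }

/-- The functor `X ↦ colim_j lim_i X_{ij}` from functors `Π ⥤ Vect₀(k)` to topological vector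
spaces: the limit over `i → -∞` and the colimit over `j → ∞` are taken in the category of
topological vector spaces, the finite-dimensional spaces `X_{ij}` being discrete. -/
noncomputable def indProLim : (TateIdx ⥤ FGModuleCat.{u} k) ⥤ TopModuleCat.{u} k :=
  (Functor.whiskeringRight _ _ _).obj (discreteFunctor k) ⋙
    Functor.whiskeringRight ℤ TateIdx (TopModuleCat.{u} k) ⋙
    (Functor.whiskeringLeft ℤ (ℤ ⥤ TateIdx) (ℤ ⥤ TopModuleCat.{u} k)).obj extendIdx ⋙
    (Functor.whiskeringRight ℤ (ℤ ⥤ TopModuleCat.{u} k) (TopModuleCat.{u} k)).obj lim ⋙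
    colim

/-- The category `𝓣 = lim↔ Vect₀(k)` of Tate vector spaces over `k`. -/
abbrev TateCat (k : Type u) [Field k] := BeilinsonCat (FGModuleCat.{u} k)

/-- The category `Pro^s(Vect₀(k))` of strict pro-finite-dimensional spaces. -/
abbrev StrictProVect (k : Type u) [Field k] := (IsStrictPro (FGModuleCat.{u} k)).FullSubcategory

/-- The category of countable strict pro-finite-dimensional spaces. -/
abbrev CountableStrictProVect (k : Type u) [Field k] :=
  (IsCountableStrictPro (FGModuleCat.{u} k)).FullSubcategory

end Spaces

/-!
A realization of an admissible functor `X` by a topological vector space `V` is a complete,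
separated, exhaustive filtration of `V` by open subspaces `L j` shrinking to `0`, together with
identifications `L j / L i ≃ X i j` compatible with the structure maps. Every `X` is realized by
`colim_j lim_i X i j`, where the `L j` are the images of the linearly compact spaces `lim_i X i j`,
and every locally linearly compact space of countable type realizes some `X`, since an open subspace
has finite codimension in every linearly compact one.

A continuous linear map preserving the filtrations is the same as a morphism of functors. A general
one maps `L (φ n)` into `L n` for some nondecreasing bicofinal `φ ≤ id`, because `L j` is generated
by finitely many vectors modulo `L i`; it is thus a fraction with denominator `X ∘ φ̃ ⟶ X`. All
morphisms of Tate spaces are fractions of this kind, hence `Φ` is fully faithful.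

A strict projective system of finite-dimensional spaces has a linearly compact limit projecting onto
each term, and the kernels of the projections form a basis of neighbourhoods of `0`. A continuous
linear map between two such limits therefore comes from a morphism of pro-objects. Conversely, a
linearly compact space is the limit of its quotients by open subspaces. The functor `lim` on
pro-objects is the right Kan extension of the discrete topology functor along the constant
pro-objects, and `E` is its restriction to countable strict pro-objects followed by an inverse of
`Φ`.
-/

universe w w'

section LinearCompactness

variable {k V W : Type*} [Field k] [AddCommGroup V] [Module k V] [AddCommGroup W] [Module k W]

/-- The finite intersection property for a family of affine subspaces, the one occurring in the
definition of linear compactness. -/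
def HasFIP (𝓕 : Set (AffineSubspace k V)) : Prop :=
  ∀ 𝓖 ⊆ 𝓕, 𝓖.Finite → ∃ x, ∀ L ∈ 𝓖, x ∈ L

theorem exists_maximal_hasFIP {𝓕 : Set (AffineSubspace k V)} (h𝓕 : HasFIP 𝓕) :
    ∃ 𝓜, 𝓕 ⊆ 𝓜 ∧ Maximal HasFIP 𝓜 := by
  have hfin : Order.IsOfFiniteCharacter {𝓜 : Set (AffineSubspace k V) | HasFIP 𝓜} := fun 𝓜 =>
    ⟨fun h 𝓖 h𝓖 _ 𝓖' h𝓖' hf => h 𝓖' (h𝓖'.trans h𝓖) hf,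
      fun h 𝓖 h𝓖 hf => h 𝓖 h𝓖 hf 𝓖 subset_rfl hf⟩
  exact hfin.exists_maximal h𝓕

theorem mem_of_maximal_hasFIP {𝓜 : Set (AffineSubspace k V)} (h𝓜 : Maximal HasFIP 𝓜)
    {K : AffineSubspace k V} (hK : ∀ 𝓖 ⊆ 𝓜, 𝓖.Finite → ∃ x ∈ K, ∀ L ∈ 𝓖, x ∈ L) : K ∈ 𝓜 := by
  refine h𝓜.2 (y := insert K 𝓜) (fun 𝓖 h𝓖 hf => ?_) (Set.subset_insert _ _) (Set.mem_insert _ _)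
  obtain ⟨x, hxK, hx⟩ := hK (𝓖 \ {K}) (by simpa using h𝓖) hf.sdiff
  refine ⟨x, fun L hL => ?_⟩
  by_cases hLK : L = K
  · exact hLK ▸ hxK
  · exact hx L ⟨hL, hLK⟩

theorem exists_mem_of_hasFIP_of_finite [Module.Finite k V] {𝓕 : Set (AffineSubspace k V)}
    (h𝓕 : HasFIP 𝓕) : ∃ x, ∀ L ∈ 𝓕, x ∈ L := by
  let I := {𝓖 : Set (AffineSubspace k V) // 𝓖 ⊆ 𝓕 ∧ 𝓖.Finite}
  have : Nonempty I := ⟨⟨∅, Set.empty_subset _, Set.finite_empty⟩⟩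
  have hne (𝓖 : I) : ((sInf 𝓖.1 : AffineSubspace k V) : Set V).Nonempty := by
    simpa [Set.Nonempty, AffineSubspace.mem_sInf_iff] using h𝓕 𝓖.1 𝓖.2.1 𝓖.2.2
  obtain ⟨𝓖, h𝓖⟩ : ∃ 𝓖 : I, ∀ 𝓖' : I,
      Module.finrank k (sInf 𝓖.1).direction ≤ Module.finrank k (sInf 𝓖'.1).direction :=
    ⟨_, fun 𝓖' => Function.argmin_le (fun 𝓖 : I => Module.finrank k (sInf 𝓖.1).direction) 𝓖'⟩
  obtain ⟨x, hx⟩ := hne 𝓖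
  refine ⟨x, fun L hL => ?_⟩
  let 𝓖' : I := ⟨insert L 𝓖.1, Set.insert_subset hL 𝓖.2.1, 𝓖.2.2.insert L⟩
  have hle : sInf 𝓖'.1 ≤ sInf 𝓖.1 := sInf_le_sInf (Set.subset_insert _ _)
  have heq : sInf 𝓖'.1 = sInf 𝓖.1 := AffineSubspace.eq_of_direction_eq_of_nonempty_of_le
    (Submodule.eq_of_le_of_finrank_le (AffineSubspace.direction_le hle) (h𝓖 𝓖')) (hne 𝓖') hle
  exact (sInf_le (Set.mem_insert L 𝓖.1) : sInf 𝓖'.1 ≤ L) (heq ▸ hx)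

variable [TopologicalSpace V]

theorem isClosed_of_forall_add_mem [IsTopologicalAddGroup V] {U : Submodule k V}
    (hU : IsOpen (U : Set V)) {s : Set V} (hs : ∀ x ∈ s, ∀ u ∈ U, x + u ∈ s) : IsClosed s := by
  rw [← isOpen_compl_iff, isOpen_iff_mem_nhds]
  intro x hx
  have : (x - ·) ⁻¹' (U : Set V) ∈ 𝓝 x :=
    (hU.preimage (continuous_const.sub continuous_id)).mem_nhds (by simp)
  filter_upwards [this] with y hy hys
  exact hx (by simpa using hs y hys (x - y) hy)

theorem isClosed_comap_mkQ [IsTopologicalAddGroup V] {U : Submodule k V}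
    (hU : IsOpen (U : Set V)) (L : AffineSubspace k (V ⧸ U)) :
    IsClosed (L.comap U.mkQ.toAffineMap : Set V) :=
  isClosed_of_forall_add_mem hU fun x hx u hu => by
    simpa [(Submodule.Quotient.mk_eq_zero U).2 hu] using hx

namespace IsLinearlyCompact

theorem exists_mem_of_hasFIP (hV : IsLinearlyCompact k V) {𝓕 : Set (AffineSubspace k V)}
    (hcl : ∀ L ∈ 𝓕, IsClosed (L : Set V)) (h𝓕 : HasFIP 𝓕) : ∃ x, ∀ L ∈ 𝓕, x ∈ L := by
  simpa [Set.Nonempty] using hV.inter_nonempty 𝓕 hcl fun 𝓖 h𝓖 => by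
    simpa [Set.Nonempty] using h𝓕 𝓖 h𝓖 𝓖.finite_toSet

theorem of_hasFIP [T2Space V] [IsLinearTopology k V]
    (h : ∀ 𝓕 : Set (AffineSubspace k V), (∀ L ∈ 𝓕, IsClosed (L : Set V)) → HasFIP 𝓕 →
      ∃ x, ∀ L ∈ 𝓕, x ∈ L) : IsLinearlyCompact k V where
  t2 := inferInstance
  linear := inferInstance
  inter_nonempty 𝓕 hcl hfip := by
    simpa [Set.Nonempty] using h 𝓕 hcl fun 𝓖 h𝓖 hf => by
      simpa [Set.Nonempty] using hfip hf.toFinset (by simpa using h𝓖)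

theorem exists_forall_mem (hV : IsLinearlyCompact k V) {I : Type*} (L : I → AffineSubspace k V)
    (hL : ∀ i, IsClosed (L i : Set V)) (hne : ∀ S : Finset I, ∃ x, ∀ i ∈ S, x ∈ L i) :
    ∃ x, ∀ i, x ∈ L i := by
  classical
  have hfip : HasFIP (Set.range L) := fun 𝓖 h𝓖 hf => by
    obtain ⟨S, -, hS⟩ := (Finset.subset_set_image_iff (s := Set.univ) (t := hf.toFinset)
      (f := L)).1 (by simpa using h𝓖)
    obtain ⟨x, hx⟩ := hne S
    refine ⟨x, fun K hK => ?_⟩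
    obtain ⟨i, hi, rfl⟩ := Finset.mem_image.1 (hS ▸ hf.mem_toFinset.2 hK)
    exact hx i hi
  simpa using hV.exists_mem_of_hasFIP (by simpa using hL) hfip

theorem exists_forall_sub_mem [IsTopologicalAddGroup V] (hV : IsLinearlyCompact k V) {I : Type*}
    {U : I → Submodule k V} (hU : ∀ i, IsOpen (U i : Set V)) (v : I → V)
    (hne : ∀ S : Finset I, ∃ x, ∀ i ∈ S, x - v i ∈ U i) : ∃ x, ∀ i, x - v i ∈ U i := by
  have hcl (i : I) : IsClosed (AffineSubspace.mk' (v i) (U i) : Set V) :=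
    isClosed_of_forall_add_mem (hU i) fun x hx u hu => by
      simp only [SetLike.mem_coe, AffineSubspace.mem_mk', vsub_eq_sub] at hx ⊢
      simpa only [add_sub_right_comm] using add_mem hx hu
  simpa [AffineSubspace.mem_mk'] using
    hV.exists_forall_mem _ hcl (by simpa [AffineSubspace.mem_mk'] using hne)

theorem finite_quotient [IsTopologicalAddGroup V] (hV : IsLinearlyCompact k V)
    {U : Submodule k V} (hU : IsOpen (U : Set V)) : Module.Finite k (V ⧸ U) := by
  -- A vector all of whose coordinates are `1` exists by linear compactness, and has finite support.
  classical
  let b := Module.Basis.ofVectorSpace k (V ⧸ U)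
  let L i : AffineSubspace k (V ⧸ U) := AffineSubspace.mk' (b i) (LinearMap.ker (b.coord i))
  have hL i x : x ∈ L i ↔ b.repr x i = 1 := by simp [L, AffineSubspace.mem_mk', sub_eq_zero]
  obtain ⟨x, hx⟩ := hV.exists_forall_mem (fun i => (L i).comap U.mkQ.toAffineMap)
    (fun i => isClosed_comap_mkQ hU (L i)) fun S => by
      obtain ⟨x, hx⟩ := U.mkQ_surjective (∑ i ∈ S, b i)
      refine ⟨x, fun i hi => ?_⟩
      simp [AffineSubspace.mem_comap, hL, hx, Finsupp.single_apply, hi]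
  have hsupp i : i ∈ (b.repr (U.mkQ x)).support :=
    Finsupp.mem_support_iff.2 (((hL i _).1 (hx i)).trans_ne one_ne_zero)
  have := Finite.of_injective (fun i => (⟨i, hsupp i⟩ : (b.repr (U.mkQ x)).support))
    fun i j h => congrArg Subtype.val h
  exact Module.Finite.of_basis b

theorem of_finite [DiscreteTopology V] [Module.Finite k V] : IsLinearlyCompact k V :=
  of_hasFIP fun _ _ => exists_mem_of_hasFIP_of_finite

theorem of_isClosedEmbedding [TopologicalSpace W] (hV : IsLinearlyCompact k V) (f : W →ₗ[k] V)
    (hf : IsClosedEmbedding f) : IsLinearlyCompact k W := by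
  have := hV.t2
  have := hf.t2Space
  have := hV.linear
  have hbasis := (IsLinearTopology.hasBasis_submodule k (M := V)).comap f
  rw [← map_zero f, ← hf.nhds_eq_comap] at hbasis
  have : IsLinearTopology k W := .mk_of_hasBasis k (s := fun N : Submodule k V => N.comap f) hbasis
  refine of_hasFIP fun 𝓕 hcl h𝓕 => ?_
  obtain ⟨y, hy⟩ := hV.exists_forall_mem (fun L : 𝓕 => L.1.map f.toAffineMap)
    (fun L => hf.isClosedMap _ (hcl L.1 L.2)) fun S => by
      obtain ⟨x, hx⟩ := h𝓕 ((↑) '' (S : Set 𝓕)) (by simp) (S.finite_toSet.image _)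
      exact ⟨f x, fun L hL => ⟨x, hx L ⟨L, hL, rfl⟩, rfl⟩⟩
  rcases 𝓕.eq_empty_or_nonempty with rfl | ⟨L, hL⟩
  · simp
  obtain ⟨x, -, rfl⟩ := hy ⟨L, hL⟩
  exact ⟨x, fun L hL => by simpa [hf.injective.eq_iff] using hy ⟨L, hL⟩⟩

theorem of_continuousLinearEquiv [TopologicalSpace W] (hV : IsLinearlyCompact k V)
    (e : V ≃L[k] W) : IsLinearlyCompact k W :=
  hV.of_isClosedEmbedding e.symm.toLinearMap e.symm.toHomeomorph.isClosedEmbedding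

theorem exists_comap_mem_of_maximal_hasFIP [IsTopologicalAddGroup V] (hV : IsLinearlyCompact k V)
    (f : W →ₗ[k] V) {𝓜 : Set (AffineSubspace k W)} (h𝓜 : Maximal HasFIP 𝓜) :
    ∃ v, ∀ U : Submodule k V, IsOpen (U : Set V) →
      (AffineSubspace.mk' v U).comap f.toAffineMap ∈ 𝓜 := by
  classical
  let I := {𝓖 : Set (AffineSubspace k W) // 𝓖 ⊆ 𝓜 ∧ 𝓖.Finite} ×
    {U : Submodule k V // IsOpen (U : Set V)}
  let L (i : I) : AffineSubspace k V :=
    ((sInf i.1.1).map (i.2.1.mkQ ∘ₗ f).toAffineMap).comap i.2.1.mkQ.toAffineMap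
  obtain ⟨v, hv⟩ := hV.exists_forall_mem L (fun i => isClosed_comap_mkQ i.2.2 _) fun S => by
    obtain ⟨x, hx⟩ := h𝓜.1 (⋃ i ∈ S, i.1.1) (Set.iUnion₂_subset fun i _ => i.1.2.1)
      (S.finite_toSet.biUnion fun i _ => i.1.2.2)
    refine ⟨f x, fun i hi => ⟨x, ?_, rfl⟩⟩
    exact (AffineSubspace.mem_sInf_iff _ _).2 fun L hL => hx L (Set.mem_biUnion hi hL)
  refine ⟨v, fun U hU => mem_of_maximal_hasFIP h𝓜 fun 𝓖 h𝓖 hf => ?_⟩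
  obtain ⟨x, hx, hxv⟩ := hv (⟨𝓖, h𝓖, hf⟩, ⟨U, hU⟩)
  refine ⟨x, ?_, (AffineSubspace.mem_sInf_iff _ _).1 hx⟩
  exact (Submodule.Quotient.eq U).1 (hxv : U.mkQ (f x) = U.mkQ v)

theorem pi {A : Type*} {E : A → Type*} [∀ a, AddCommGroup (E a)] [∀ a, Module k (E a)]
    [∀ a, TopologicalSpace (E a)] [∀ a, IsTopologicalAddGroup (E a)]
    (hE : ∀ a, IsLinearlyCompact k (E a)) : IsLinearlyCompact k (∀ a, E a) := by
  classical
  have := fun a => (hE a).t2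
  have := fun a => (hE a).linear
  have hbasis := Filter.hasBasis_pi fun a =>
    IsLinearTopology.hasBasis_open_submodule k (M := E a)
  rw [← nhds_pi] at hbasis
  have : IsLinearTopology k (∀ a, E a) := .mk_of_hasBasis k
    (s := fun U : Set A × ∀ a, Submodule k (E a) => Submodule.pi U.1 U.2) hbasis
  refine of_hasFIP fun 𝓕 hcl h𝓕 => ?_
  obtain ⟨𝓜, h𝓕𝓜, h𝓜⟩ := exists_maximal_hasFIP h𝓕
  choose e he using fun a => (hE a).exists_comap_mem_of_maximal_hasFIP (LinearMap.proj a) h𝓜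
  refine ⟨e, fun L hL => ?_⟩
  rw [← SetLike.mem_coe, ← (hcl L hL).closure_eq, mem_closure_iff_nhds_zero]
  intro N hN
  obtain ⟨⟨S, U⟩, ⟨hS, hU⟩, hUN⟩ := hbasis.mem_iff.1 hN
  obtain ⟨y, hy⟩ := h𝓜.1
    (insert L ((fun a => (AffineSubspace.mk' (e a) (U a)).comap
      (LinearMap.proj (R := k) (φ := E) a).toAffineMap) '' S))
    (Set.insert_subset (h𝓕𝓜 hL) (Set.image_subset_iff.2 fun a ha => he a _ (hU a ha)))
    ((hS.image _).insert _)
  refine ⟨y, hy L (Set.mem_insert _ _), hUN fun a ha => ?_⟩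
  exact hy _ (Set.mem_insert_of_mem _ ⟨a, ha, rfl⟩)

end IsLinearlyCompact

end LinearCompactness

section Limits

variable {k : Type u} [Field k] [TopologicalSpace k] {J : Type w} [Category.{w'} J]

theorem nonempty_isLimit_iff_existsUnique {F : J ⥤ TopModuleCat.{u} k} (c : Cone F) :
    Nonempty (IsLimit c) ↔
      c.pt.topologicalSpace = ⨅ j, (F.obj j).topologicalSpace.induced (c.π.app j).hom ∧
      ∀ e : ∀ j, F.obj j, (∀ ⦃a b : J⦄ (f : a ⟶ b), (F.map f).hom (e a) = e b) →
        ∃! x : c.pt, ∀ j, (c.π.app j).hom x = e j := by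
  let G := forget₂ (TopModuleCat.{u} k) TopCat.{u}
  have hsections : Nonempty (IsLimit ((forget TopCat.{u}).mapCone (G.mapCone c))) ↔
      ∀ e : ∀ j, F.obj j, (∀ ⦃a b : J⦄ (f : a ⟶ b), (F.map f).hom (e a) = e b) →
        ∃! x : c.pt, ∀ j, (c.π.app j).hom x = e j :=
    Types.isLimit_iff _
  rw [← hsections]
  refine ⟨fun ⟨hc⟩ => ?_, fun ⟨htop, ⟨hc⟩⟩ => ?_⟩
  · have hGc := isLimitOfPreserves G hc
    exact ⟨TopCat.induced_of_isLimit _ hGc, ⟨isLimitOfPreserves _ hGc⟩⟩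
  · have : HasLimit (F ⋙ forget₂ _ (ModuleCat.{u} k) ⋙ forget (ModuleCat.{u} k)) := ⟨⟨_, hc⟩⟩
    have : Small.{u} ((F ⋙ forget₂ _ (ModuleCat.{u} k)) ⋙ forget (ModuleCat.{u} k)).sections :=
      (Types.hasLimit_iff_small_sections _).1 this
    have : ReflectsLimit F G := reflectsLimit_of_reflectsIsomorphisms _ _
    exact ⟨isLimitOfReflects G ((TopCat.nonempty_isLimit_iff_eq_induced _ hc).2 htop).some⟩

variable {F : J ⥤ TopModuleCat.{u} k}

theorem topologicalSpace_eq_iInf_induced_iff (c : Cone F) :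
    c.pt.topologicalSpace = ⨅ j, (F.obj j).topologicalSpace.induced (c.π.app j).hom ↔
      𝓝 (0 : c.pt) = ⨅ j, (𝓝 (0 : F.obj j)).comap (c.π.app j).hom := by
  have hgroup : @IsTopologicalAddGroup c.pt
      (⨅ j, (F.obj j).topologicalSpace.induced (c.π.app j).hom) _ :=
    topologicalAddGroup_iInf fun j => topologicalAddGroup_induced (c.π.app j).hom
  have hnhds : @nhds c.pt (⨅ j, (F.obj j).topologicalSpace.induced (c.π.app j).hom) 0 =
      ⨅ j, (𝓝 (0 : F.obj j)).comap (c.π.app j).hom := by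
    simp only [nhds_iInf, nhds_induced, map_zero]
  exact ⟨fun h => (congrArg (fun t => @nhds c.pt t 0) h).trans hnhds,
    fun h => IsTopologicalAddGroup.ext inferInstance hgroup (h.trans hnhds.symm)⟩

theorem exists_forall_map_eq_of_surjective [IsCofiltered J]
    (hF : ∀ ⦃a b : J⦄ (f : a ⟶ b), Function.Surjective (F.map f).hom)
    (T : Finset (Σ a b : J, a ⟶ b)) (j : J) (e : F.obj j) :
    ∃ x : ∀ a, F.obj a, x j = e ∧ ∀ f ∈ T, (F.map f.2.2).hom (x f.1) = x f.2.1 := by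
  classical
  let O : Finset J := insert j (T.image (fun f => f.1) ∪ T.image (fun f => f.2.1))
  have hj : j ∈ O := Finset.mem_insert_self _ _
  have hsource {f} (hf : f ∈ T) : f.1 ∈ O :=
    Finset.mem_insert_of_mem (Finset.mem_union_left _ (Finset.mem_image_of_mem _ hf))
  have htarget {f} (hf : f ∈ T) : f.2.1 ∈ O :=
    Finset.mem_insert_of_mem (Finset.mem_union_right _
      (Finset.mem_image_of_mem (fun f : Σ a b : J, a ⟶ b => f.2.1) hf))
  let H : Finset (Σ' (a b : J) (_ : a ∈ O) (_ : b ∈ O), a ⟶ b) :=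
    T.attach.image fun f => ⟨f.1.1, f.1.2.1, hsource f.2, htarget f.2, f.1.2.2⟩
  obtain ⟨z, t, ht⟩ := IsCofiltered.inf_exists O H
  obtain ⟨w, hw⟩ := hF (t hj) e
  let x (a : J) : F.obj a := if h : a ∈ O then (F.map (t h)).hom w else 0
  have hx {a} (ha : a ∈ O) : x a = (F.map (t ha)).hom w := dif_pos ha
  refine ⟨x, (hx hj).trans hw, fun f hf => ?_⟩
  have hcomm : t (hsource hf) ≫ f.2.2 = t (htarget hf) :=
    ht _ _ (Finset.mem_image.2 ⟨⟨f, hf⟩, Finset.mem_attach _ _, rfl⟩)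
  rw [hx (hsource hf), hx (htarget hf), ← hcomm, F.map_comp]
  rfl

variable {c : Cone F} (hc : IsLimit c)
include hc

theorem isLimit_injective : Function.Injective fun (x : c.pt) j => (c.π.app j).hom x := by
  intro x y h
  have he a b (f : a ⟶ b) : (F.map f).hom ((c.π.app a).hom x) = (c.π.app b).hom x :=
    congrArg (fun g : c.pt ⟶ F.obj b => g.hom x) (c.w f)
  exact (((nonempty_isLimit_iff_existsUnique c).1 ⟨hc⟩).2 _ he).unique (fun _ => rfl)
    fun j => (congrFun h j).symm

theorem isLimit_range :
    Set.range (fun (x : c.pt) j => (c.π.app j).hom x) =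
      {e | ∀ ⦃a b : J⦄ (f : a ⟶ b), (F.map f).hom (e a) = e b} := by
  ext e
  refine ⟨?_, fun he => ?_⟩
  · rintro ⟨x, rfl⟩ a b f
    exact congrArg (fun g : c.pt ⟶ F.obj b => g.hom x) (c.w f)
  · obtain ⟨x, hx, -⟩ := ((nonempty_isLimit_iff_existsUnique c).1 ⟨hc⟩).2 e he
    exact ⟨x, funext hx⟩

theorem isLimit_isClosedEmbedding [∀ j, T2Space (F.obj j)] :
    IsClosedEmbedding fun (x : c.pt) j => (c.π.app j).hom x where
  injective := isLimit_injective hc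
  eq_induced := by
    have := ((nonempty_isLimit_iff_existsUnique c).1 ⟨hc⟩).1
    refine this.trans ?_
    rw [Pi.topologicalSpace, induced_iInf]
    simp only [induced_compose]
    rfl
  isClosed_range := by
    rw [isLimit_range hc]
    simp only [Set.ofPred_forall]
    refine isClosed_iInter fun a => isClosed_iInter fun b => isClosed_iInter fun f => ?_
    exact isClosed_eq ((F.map f).hom.continuous.comp (continuous_apply a)) (continuous_apply b)

theorem IsLinearlyCompact.of_isLimit (hF : ∀ j, IsLinearlyCompact k (F.obj j)) :
    IsLinearlyCompact k c.pt := by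
  have := fun j => (hF j).t2
  exact (IsLinearlyCompact.pi hF).of_isClosedEmbedding
    (LinearMap.pi fun j => (c.π.app j).hom.toLinearMap) (isLimit_isClosedEmbedding hc)

theorem isLimit_surjective [IsCofiltered J] (hF : ∀ j, IsLinearlyCompact k (F.obj j))
    (hsurj : ∀ ⦃a b : J⦄ (f : a ⟶ b), Function.Surjective (F.map f).hom) (j : J) :
    Function.Surjective (c.π.app j).hom := by
  classical
  intro e
  let L : Option (Σ a b : J, a ⟶ b) → AffineSubspace k (∀ a, F.obj a)
    | none => (AffineSubspace.mk' e ⊥).comap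
        (LinearMap.proj (R := k) (φ := fun a => F.obj a) j).toAffineMap
    | some f => (LinearMap.ker ((F.map f.2.2).hom.toLinearMap ∘ₗ
        LinearMap.proj (R := k) (φ := fun a => F.obj a) f.1 -
          LinearMap.proj (R := k) (φ := fun a => F.obj a) f.2.1)).toAffineSubspace
  have hnone x : x ∈ L none ↔ x j = e := by simp [L, AffineSubspace.mem_mk', sub_eq_zero]
  have hsome x f : x ∈ L (some f) ↔ (F.map f.2.2).hom (x f.1) = x f.2.1 := by
    simp [L, sub_eq_zero]
  have hclosed i : IsClosed (L i : Set (∀ a, F.obj a)) := by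
    have := fun a => (hF a).t2
    cases i with
    | none =>
      rw [show (L none : Set (∀ a, F.obj a)) = {x | x j = e} from Set.ext hnone]
      exact isClosed_eq (continuous_apply j) continuous_const
    | some f =>
      rw [show (L (some f) : Set (∀ a, F.obj a)) =
        {x | (F.map f.2.2).hom (x f.1) = x f.2.1} from Set.ext fun x => hsome x f]
      exact isClosed_eq ((F.map f.2.2).hom.continuous.comp (continuous_apply f.1))
        (continuous_apply f.2.1)
  obtain ⟨x, hx⟩ := (IsLinearlyCompact.pi hF).exists_forall_mem L hclosed fun S => by
    obtain ⟨x, hxj, hxf⟩ := exists_forall_map_eq_of_surjective hsurj S.eraseNone j e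
    refine ⟨x, ?_⟩
    rintro (_ | f) hi
    · exact (hnone x).2 hxj
    · exact (hsome x f).2 (hxf f (Finset.mem_eraseNone.2 hi))
  obtain ⟨y, hy, -⟩ := ((nonempty_isLimit_iff_existsUnique c).1 ⟨hc⟩).2 x
    fun a b f => (hsome x ⟨a, b, f⟩).1 (hx (some ⟨a, b, f⟩))
  exact ⟨y, (hy j).trans ((hnone x).1 (hx none))⟩

end Limits

section DiscreteLimits

variable {k : Type u} [Field k] [TopologicalSpace k] [DiscreteTopology k]

namespace discreteFunctor

instance (E : FGModuleCat.{u} k) : DiscreteTopology ((discreteFunctor k).obj E) := ⟨rfl⟩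

variable {X : TopModuleCat.{u} k} {E : FGModuleCat.{u} k}

/-- The linear map underlying a morphism to a discrete space. -/
def toLin (f : X ⟶ (discreteFunctor k).obj E) : X →ₗ[k] E := f.hom.toLinearMap

/-- The morphism to a discrete space given by a linear map with open kernel. -/
def ofLin (f : X →ₗ[k] E) (hf : IsOpen (f.ker : Set X)) : X ⟶ (discreteFunctor k).obj E :=
  ConcreteCategory.ofHom (C := TopModuleCat k) (Y := (discreteFunctor k).obj E)
    ⟨f, by
      let g : X →ₗ[k] (discreteFunctor k).obj E := f
      refine continuous_of_continuousAt_zero g ?_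
      rw [ContinuousAt, map_zero, nhds_discrete ((discreteFunctor k).obj E), Filter.tendsto_pure]
      exact hf.mem_nhds (zero_mem f.ker)⟩

theorem toLin_injective {f g : X ⟶ (discreteFunctor k).obj E} (h : toLin f = toLin g) : f = g :=
  ConcreteCategory.hom_ext _ _ fun x => LinearMap.congr_fun h x

theorem isOpen_ker_toLin (f : X ⟶ (discreteFunctor k).obj E) : IsOpen ((toLin f).ker : Set X) :=
  (isOpen_discrete {(0 : (discreteFunctor k).obj E)}).preimage f.hom.continuous

theorem isLinearlyCompact_obj (E : FGModuleCat.{u} k) :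
    IsLinearlyCompact k ((discreteFunctor k).obj E) :=
  have : Module.Finite k ((discreteFunctor k).obj E) := inferInstanceAs (Module.Finite k E)
  .of_finite

variable {J : Type w} [Category.{w'} J] {G : J ⥤ FGModuleCat.{u} k}

/-- The linear projections of a cone of discrete spaces. -/
def coneProj (c : Cone (G ⋙ discreteFunctor k)) (j : J) : c.pt →ₗ[k] G.obj j :=
  toLin (X := c.pt) (E := G.obj j) (c.π.app j)

theorem isOpen_ker_coneProj (c : Cone (G ⋙ discreteFunctor k)) (j : J) :
    IsOpen ((coneProj c j).ker : Set c.pt) :=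
  isOpen_ker_toLin (X := c.pt) (E := G.obj j) (c.π.app j)

theorem map_coneProj (c : Cone (G ⋙ discreteFunctor k)) {a b : J} (f : a ⟶ b) (x : c.pt) :
    (G.map f).hom.hom (coneProj c a x) = coneProj c b x :=
  congrArg (fun g => toLin (X := c.pt) (E := G.obj b) g x) (c.w f)

theorem nonempty_isLimit_iff (c : Cone (G ⋙ discreteFunctor k)) :
    Nonempty (IsLimit c) ↔
      𝓝 (0 : c.pt) = ⨅ j, Filter.principal ((coneProj c j).ker : Set c.pt) ∧
      ∀ e : ∀ j, G.obj j, (∀ ⦃a b : J⦄ (f : a ⟶ b), (G.map f).hom.hom (e a) = e b) →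
        ∃! x : c.pt, ∀ j, coneProj c j x = e j := by
  have hker j : (𝓝 (0 : (discreteFunctor k).obj (G.obj j))).comap (c.π.app j).hom =
      Filter.principal ((coneProj c j).ker : Set c.pt) := by
    rw [nhds_discrete, ← Filter.principal_singleton, Filter.comap_principal]
    rfl
  rw [nonempty_isLimit_iff_existsUnique, topologicalSpace_eq_iInf_induced_iff]
  exact and_congr (Eq.congr_right (iInf_congr hker)) Iff.rfl

theorem hasBasis_ker_coneProj [IsCofiltered J] (c : Cone (G ⋙ discreteFunctor k))
    (h : 𝓝 (0 : c.pt) = ⨅ j, Filter.principal ((coneProj c j).ker : Set c.pt)) :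
    (𝓝 (0 : c.pt)).HasBasis (fun _ => True) fun j => ((coneProj c j).ker : Set c.pt) := by
  have : Nonempty J := IsCofiltered.nonempty
  rw [h]
  refine Filter.hasBasis_iInf_principal fun a b => ?_
  refine ⟨IsCofiltered.min a b, fun x (hx : _ = _) => ?_, fun x (hx : _ = _) => ?_⟩
  · exact (map_coneProj c (IsCofiltered.minToLeft a b) x).symm.trans (by rw [hx, map_zero])
  · exact (map_coneProj c (IsCofiltered.minToRight a b) x).symm.trans (by rw [hx, map_zero])

section

variable {c : Cone (G ⋙ discreteFunctor k)} (hc : IsLimit c)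
include hc

theorem limit_nhds_zero :
    𝓝 (0 : c.pt) = ⨅ j, Filter.principal ((coneProj c j).ker : Set c.pt) :=
  ((nonempty_isLimit_iff c).1 ⟨hc⟩).1

theorem limit_hasBasis [IsCofiltered J] :
    (𝓝 (0 : c.pt)).HasBasis (fun _ => True) fun j => ((coneProj c j).ker : Set c.pt) :=
  hasBasis_ker_coneProj c (limit_nhds_zero hc)

theorem limit_isCountablyGenerated [Countable J] : (𝓝 (0 : c.pt)).IsCountablyGenerated := by
  rw [limit_nhds_zero hc]
  infer_instance

theorem limit_exists (e : ∀ j, G.obj j)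
    (he : ∀ ⦃a b : J⦄ (f : a ⟶ b), (G.map f).hom.hom (e a) = e b) :
    ∃ x : c.pt, ∀ j, coneProj c j x = e j :=
  (((nonempty_isLimit_iff c).1 ⟨hc⟩).2 e he).exists

theorem limit_ext {x y : c.pt} (h : ∀ j, coneProj c j x = coneProj c j y) : x = y :=
  isLimit_injective hc (funext h)

theorem limit_isLinearlyCompact : IsLinearlyCompact k c.pt :=
  .of_isLimit hc fun j => isLinearlyCompact_obj (G.obj j)

theorem limit_surjective [IsCofiltered J]
    (hG : ∀ ⦃a b : J⦄ (f : a ⟶ b), Function.Surjective (G.map f).hom.hom) (j : J) :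
    Function.Surjective (coneProj c j) :=
  isLimit_surjective hc (fun j => isLinearlyCompact_obj (G.obj j)) hG j

end

theorem nonempty_isLimit_of_isLinearlyCompact [IsCofiltered J] (c : Cone (G ⋙ discreteFunctor k))
    (hV : IsLinearlyCompact k c.pt) (hsurj : ∀ j, Function.Surjective (coneProj c j))
    (hbasis : (𝓝 (0 : c.pt)).HasBasis (fun _ => True) fun j => ((coneProj c j).ker : Set c.pt)) :
    Nonempty (IsLimit c) := by
  have := hV.t2
  refine (nonempty_isLimit_iff c).2 ⟨hbasis.eq_iInf, fun e he => ?_⟩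
  choose v hv using fun j => hsurj j (e j)
  have hmem j x : x - v j ∈ (coneProj c j).ker ↔ coneProj c j x = e j := by
    rw [LinearMap.mem_ker, map_sub, hv, sub_eq_zero]
  obtain ⟨x, hx⟩ := hV.exists_forall_sub_mem (isOpen_ker_coneProj c) v fun S => by
    obtain ⟨j, hj⟩ := IsCofiltered.inf_objs_exists S
    refine ⟨v j, fun a ha => (hmem a _).2 ?_⟩
    obtain ⟨f⟩ := hj ha
    rw [← map_coneProj c f, hv, he]
  refine ⟨x, fun j => (hmem j x).1 (hx j), fun y hy => ?_⟩
  refine sub_eq_zero.1 (not_not.1 fun hne => ?_)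
  obtain ⟨j, -, hj⟩ := hbasis.mem_iff.1 (isOpen_compl_singleton.mem_nhds (Ne.symm hne))
  exact hj (show coneProj c j (y - x) = 0 by rw [map_sub, hy, (hmem j x).1 (hx j), sub_self]) rfl

end discreteFunctor

end DiscreteLimits

section Admissible

variable {k : Type u} [Field k]

theorem fgModuleCat_epi_iff_surjective {E E' : FGModuleCat.{v} k} (f : E ⟶ E') :
    Epi f ↔ Function.Surjective f.hom.hom := by
  rw [← Functor.epi_map_iff_epi (forget₂ (FGModuleCat.{v} k) (ModuleCat.{v} k)),
    ModuleCat.epi_iff_surjective]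
  rfl

theorem fgModuleCat_mono_iff_injective {E E' : FGModuleCat.{v} k} (f : E ⟶ E') :
    Mono f ↔ Function.Injective f.hom.hom := by
  rw [← Functor.mono_map_iff_mono (forget₂ (FGModuleCat.{v} k) (ModuleCat.{v} k)),
    ModuleCat.mono_iff_injective]
  rfl

theorem fgModuleCat_shortExact_iff {S : ShortComplex (FGModuleCat.{v} k)} :
    S.ShortExact ↔ Function.Injective S.f.hom.hom ∧ Function.Surjective S.g.hom.hom ∧
      ∀ y, S.g.hom.hom y = 0 → ∃ x, S.f.hom.hom x = y := by
  have hexact : S.Exact ↔ ∀ y, S.g.hom.hom y = 0 → ∃ x, S.f.hom.hom x = y := by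
    rw [← ShortComplex.exact_map_iff_of_faithful S
      (forget₂ (FGModuleCat.{v} k) (ModuleCat.{v} k)), ShortComplex.moduleCat_exact_iff]
    rfl
  rw [← hexact, ← fgModuleCat_mono_iff_injective, ← fgModuleCat_epi_iff_surjective]
  exact ⟨fun h => ⟨h.mono_f, h.epi_g, h.exact⟩, fun ⟨hf, hg, h⟩ =>
    { exact := h, mono_f := hf, epi_g := hg }⟩

theorem TateIdx.map_map (X : TateIdx ⥤ FGModuleCat.{v} k) {p q r : TateIdx} (f : p ⟶ q)
    (g : q ⟶ r) (h : p ⟶ r) (x : X.obj p) :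
    (X.map g).hom.hom ((X.map f).hom.hom x) = (X.map h).hom.hom x := by
  rw [Subsingleton.elim h (f ≫ g), X.map_comp]
  rfl

theorem TateIdx.map_self (X : TateIdx ⥤ FGModuleCat.{v} k) {p : TateIdx} (f : p ⟶ p)
    (x : X.obj p) : (X.map f).hom.hom x = x := by
  rw [Subsingleton.elim f (𝟙 p), X.map_id]
  rfl

namespace IsAdmissibleBiFun

variable {X : TateIdx ⥤ FGModuleCat.{v} k} (hX : IsAdmissibleBiFun _ X) {p q r : TateIdx}
include hX

theorem map_injective (f : p ⟶ q) (h : p.1.1 = q.1.1) : Function.Injective (X.map f).hom.hom := by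
  obtain ⟨⟨i, j⟩, hij⟩ := p
  obtain ⟨⟨i', l⟩, hil⟩ := q
  obtain rfl : i = i' := h
  obtain ⟨_, h⟩ := hX i j l hij (leOfHom f).2
  exact (fgModuleCat_shortExact_iff.1 h).1

theorem map_surjective (f : p ⟶ q) (h : p.1.2 = q.1.2) :
    Function.Surjective (X.map f).hom.hom := by
  obtain ⟨⟨i, l⟩, hil⟩ := p
  obtain ⟨⟨j, l'⟩, hjl⟩ := q
  obtain rfl : l = l' := h
  obtain ⟨_, h⟩ := hX i j l (leOfHom f).1 hjl
  exact (fgModuleCat_shortExact_iff.1 h).2.1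

theorem map_eq_zero_iff (f : p ⟶ q) (g : q ⟶ r) (hpq : p.1.1 = q.1.1) (hpr : p.1.2 = r.1.1)
    (hqr : q.1.2 = r.1.2) (y : X.obj q) :
    (X.map g).hom.hom y = 0 ↔ ∃ x, (X.map f).hom.hom x = y := by
  obtain ⟨⟨i, j⟩, hij⟩ := p
  obtain ⟨⟨i', l⟩, hil⟩ := q
  obtain ⟨⟨j', l'⟩, hjl⟩ := r
  obtain rfl : i = i' := hpq
  obtain rfl : j = j' := hpr
  obtain rfl : l = l' := hqr
  obtain ⟨w, h⟩ := hX i j l hij hjl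
  refine ⟨(fgModuleCat_shortExact_iff.1 h).2.2 y, ?_⟩
  rintro ⟨x, rfl⟩
  exact congrArg (fun f => f.hom.hom x) w

theorem eq_zero (h : p.1.1 = p.1.2) (x : X.obj p) : x = 0 := by
  rw [← TateIdx.map_self X (𝟙 p) x, hX.map_eq_zero_iff (𝟙 p) (𝟙 p) rfl h.symm rfl]
  exact ⟨x, TateIdx.map_self X _ x⟩

end IsAdmissibleBiFun

end Admissible

section TateFiltrations

theorem Bicofinal.exists_apply_le (φ : Bicofinal) (n : ℤ) : ∃ m, φ.toFun m ≤ n :=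
  (φ.tendsto_atBot.eventually (Filter.eventually_le_atBot n)).exists

theorem Bicofinal.exists_le_apply (φ : Bicofinal) (n : ℤ) : ∃ m, n ≤ φ.toFun m :=
  (φ.tendsto_atTop.eventually (Filter.eventually_ge_atTop n)).exists

variable {k V : Type*} [Field k] [AddCommGroup V] [Module k V] [TopologicalSpace V]

/-- A complete, separated and exhaustive filtration of a topological vector space by open subspaces
that shrink to zero. -/
structure IsTateFiltration (L : ℤ → Submodule k V) : Prop where
  mono : Monotone L
  isOpen : ∀ j, IsOpen (L j : Set V)
  exists_le : ∀ U ∈ 𝓝 (0 : V), ∃ j, (L j : Set V) ⊆ U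
  exists_mem : ∀ x, ∃ j, x ∈ L j
  separated : ∀ x, (∀ j, x ∈ L j) → x = 0
  complete : ∀ v : ℤ → V, (∀ i i', i ≤ i' → v i - v i' ∈ L i') → ∃ x, ∀ i, x - v i ∈ L i

namespace IsTateFiltration

variable {L : ℤ → Submodule k V} (hL : IsTateFiltration L)
include hL

theorem hasBasis : (𝓝 (0 : V)).HasBasis (fun _ => True) fun j => (L j : Set V) :=
  ⟨fun U => ⟨fun hU => by simpa using hL.exists_le U hU, fun ⟨j, _, h⟩ =>
    Filter.mem_of_superset ((hL.isOpen j).mem_nhds (zero_mem _)) h⟩⟩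

theorem t2Space [IsTopologicalAddGroup V] : T2Space V := by
  refine IsTopologicalAddGroup.t2Space_of_zero_sep fun x hx => ?_
  obtain ⟨j, hj⟩ := not_forall.1 fun h => hx (hL.separated x h)
  exact ⟨L j, (hL.isOpen j).mem_nhds (zero_mem _), hj⟩

theorem comp (φ : Bicofinal) : IsTateFiltration fun n => L (φ.toFun n) where
  mono _ _ h := hL.mono (φ.monotone' h)
  isOpen _ := hL.isOpen _
  exists_le U hU := by
    obtain ⟨j, hj⟩ := hL.exists_le U hU
    obtain ⟨m, hm⟩ := φ.exists_apply_le j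
    exact ⟨m, subset_trans (hL.mono hm) hj⟩
  exists_mem x := by
    obtain ⟨j, hj⟩ := hL.exists_mem x
    obtain ⟨m, hm⟩ := φ.exists_le_apply j
    exact ⟨m, hL.mono hm hj⟩
  separated x hx := hL.separated x fun j => by
    obtain ⟨m, hm⟩ := φ.exists_apply_le j
    exact hL.mono hm (hx m)
  complete v hv := by
    choose s hs using φ.exists_apply_le
    have hcauchy i n l (hi : φ.toFun i ≤ l) (hn : φ.toFun n ≤ l) : v i - v n ∈ L l := by
      have hmin_i := hL.mono hi (hv (min i n) i (min_le_left _ _))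
      have hmin_n := hL.mono hn (hv (min i n) n (min_le_right _ _))
      simpa using sub_mem hmin_n hmin_i
    obtain ⟨x, hx⟩ := hL.complete (fun n => v (s n)) fun i i' h =>
      hcauchy _ _ _ ((hs i).trans h) (hs i')
    exact ⟨x, fun i => by
      simpa using add_mem (hx (φ.toFun i)) (hcauchy (s (φ.toFun i)) i _ (hs _) le_rfl)⟩

end IsTateFiltration

end TateFiltrations

section TateRealizations

variable {k : Type u} [Field k] [TopologicalSpace k]

/-- A realization of a functor `X` on `Π` by a topological vector space `V`: a Tate filtration `L`
of `V` with subquotients `L j / L i ≃ X i j`. -/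
structure TateRealization (X : TateIdx ⥤ FGModuleCat.{u} k) (V : TopModuleCat.{u} k) where
  /-- The filtration. -/
  L : ℤ → Submodule k V
  isTateFiltration : IsTateFiltration L
  /-- The projections to the subquotients. -/
  proj : ∀ q : TateIdx, L q.1.2 →ₗ[k] X.obj q
  proj_surjective : ∀ q, Function.Surjective (proj q)
  proj_eq_zero_iff : ∀ q x, proj q x = 0 ↔ (x : V) ∈ L q.1.1
  map_proj : ∀ {q q' : TateIdx} (f : q ⟶ q') (x : L q.1.2),
    (X.map f).hom.hom (proj q x) = proj q' ⟨x, isTateFiltration.mono (leOfHom f).2 x.2⟩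

namespace TateRealization

variable {X Y Z : TateIdx ⥤ FGModuleCat.{u} k} {V W U : TopModuleCat.{u} k}
  (R : TateRealization X V) (S : TateRealization Y W) (Q : TateRealization Z U)

theorem mono : Monotone R.L := R.isTateFiltration.mono

theorem proj_eq_iff (q : TateIdx) (x y : R.L q.1.2) :
    R.proj q x = R.proj q y ↔ (x : V) - y ∈ R.L q.1.1 := by
  rw [← sub_eq_zero, ← map_sub, R.proj_eq_zero_iff]
  rfl

theorem ext_of_proj {j : ℤ} {x y : R.L j}
    (h : ∀ i, R.proj ((extendIdx.obj j).obj i) x = R.proj ((extendIdx.obj j).obj i) y) : x = y :=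
  Subtype.ext <| sub_eq_zero.1 <| R.isTateFiltration.separated _ fun i =>
    R.mono (min_le_left i j) ((R.proj_eq_iff ((extendIdx.obj j).obj i) x y).1 (h i))

theorem exists_proj_eq {j : ℤ} (e : ∀ i, X.obj ((extendIdx.obj j).obj i))
    (he : ∀ ⦃i i' : ℤ⦄ (f : i ⟶ i'), (X.map ((extendIdx.obj j).map f)).hom.hom (e i) = e i') :
    ∃ x : R.L j, ∀ i, R.proj ((extendIdx.obj j).obj i) x = e i := by
  choose v hv using fun i => R.proj_surjective ((extendIdx.obj j).obj i) (e i)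
  obtain ⟨x, hx⟩ := R.isTateFiltration.complete (fun i => v i) fun i i' h => by
    refine R.mono (min_le_left i' j) ((R.proj_eq_iff ((extendIdx.obj j).obj i') (v i) (v i')).1 ?_)
    rw [hv, ← he (homOfLE h), ← hv, R.map_proj]
    rfl
  have hxj : x ∈ R.L j := by simpa using add_mem (hx j) (v j).2
  refine ⟨⟨x, hxj⟩, fun i => ?_⟩
  refine ((R.proj_eq_iff ((extendIdx.obj j).obj i) ⟨x, hxj⟩ (v i)).2 ?_).trans (hv i)
  obtain h | h := min_choice i j
  · exact (congrArg R.L h).ge (hx i)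
  · exact (congrArg R.L h).ge (sub_mem hxj (v i).2)

/-- The vectors `x` and `y` correspond to each other under `f`: in every subquotient in which `x`
has an image, the image of `y` is defined and is the value of `f` at the image of `x`. -/
def Corr (f : X ⟶ Y) (x : V) (y : W) : Prop :=
  ∀ (q : TateIdx) (hx : x ∈ R.L q.1.2), ∃ hy : y ∈ S.L q.1.2,
    S.proj q ⟨y, hy⟩ = (f.app q).hom.hom (R.proj q ⟨x, hx⟩)

/-- A morphism `T` of topological vector spaces respects the filtrations and induces `f` on the
subquotients. -/
def Compat (f : X ⟶ Y) (T : V ⟶ W) : Prop :=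
  ∀ x, R.Corr S f x (T.hom x)

variable {R S Q}

theorem app_map_proj (f : X ⟶ Y) {q q' : TateIdx} (a : q ⟶ q') {x : R.L q.1.2} {y : S.L q.1.2}
    (h : S.proj q y = (f.app q).hom.hom (R.proj q x)) :
    S.proj q' ⟨y, S.mono (leOfHom a).2 y.2⟩ =
      (f.app q').hom.hom (R.proj q' ⟨x, R.mono (leOfHom a).2 x.2⟩) := by
  rw [← S.map_proj a, ← R.map_proj a, h]
  exact (congrArg (fun g => g.hom.hom (R.proj q x)) (f.naturality a)).symm

theorem Corr.of_forall_proj {f : X ⟶ Y} {j : ℤ} {x : R.L j} {y : S.L j}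
    (h : ∀ i, S.proj ((extendIdx.obj j).obj i) y =
      (f.app _).hom.hom (R.proj ((extendIdx.obj j).obj i) x)) : R.Corr S f x y := by
  intro q hx
  obtain ⟨w, hw⟩ := S.proj_surjective q ((f.app q).hom.hom (R.proj q ⟨x, hx⟩))
  let m : TateIdx := .mk q.1.1 (max q.1.2 j) (q.2.trans (le_max_left _ _))
  have hwm := app_map_proj f (homOfLE ⟨le_rfl, le_max_left _ _⟩ : q ⟶ m) hw
  have hym := app_map_proj f
    (homOfLE ⟨min_le_left _ _, le_max_right _ _⟩ : (extendIdx.obj j).obj q.1.1 ⟶ m) (h q.1.1)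
  have hyw : (y : W) - w ∈ S.L q.1.1 := (S.proj_eq_iff m _ _).1 (hym.trans hwm.symm)
  have hy : (y : W) ∈ S.L q.1.2 := by simpa using add_mem (S.mono q.2 hyw) w.2
  exact ⟨hy, ((S.proj_eq_iff q ⟨y, hy⟩ w).2 hyw).trans hw⟩

theorem Corr.unique {f : X ⟶ Y} {x : V} {y y' : W} (h : R.Corr S f x y) (h' : R.Corr S f x y') :
    y = y' := by
  obtain ⟨j, hj⟩ := R.isTateFiltration.exists_mem x
  choose hy hyf using fun i => h ((extendIdx.obj j).obj i) hj
  choose hy' hyf' using fun i => h' ((extendIdx.obj j).obj i) hj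
  exact congrArg Subtype.val (S.ext_of_proj (x := ⟨y, hy j⟩) (y := ⟨y', hy' j⟩)
    fun i => (hyf i).trans (hyf' i).symm)

theorem Corr.add {f : X ⟶ Y} {x x' : V} {y y' : W} (h : R.Corr S f x y) (h' : R.Corr S f x' y') :
    R.Corr S f (x + x') (y + y') := by
  obtain ⟨j, hj⟩ := R.isTateFiltration.exists_mem x
  obtain ⟨j', hj'⟩ := R.isTateFiltration.exists_mem x'
  have hx := R.mono (le_max_left j j') hj
  have hx' := R.mono (le_max_right j j') hj'
  choose hy hyf using fun i => h ((extendIdx.obj (max j j')).obj i) hx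
  choose hy' hyf' using fun i => h' ((extendIdx.obj (max j j')).obj i) hx'
  refine Corr.of_forall_proj (x := ⟨x, hx⟩ + ⟨x', hx'⟩) (y := ⟨y, hy j⟩ + ⟨y', hy' j⟩) fun i => ?_
  refine ((S.proj ((extendIdx.obj _).obj i)).map_add ⟨y, hy i⟩ ⟨y', hy' i⟩).trans ?_
  rw [hyf, hyf', ← map_add, ← map_add]
  rfl

theorem Corr.smul {f : X ⟶ Y} {x : V} {y : W} (h : R.Corr S f x y) (t : k) :
    R.Corr S f (t • x) (t • y) := by
  obtain ⟨j, hj⟩ := R.isTateFiltration.exists_mem x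
  choose hy hyf using fun i => h ((extendIdx.obj j).obj i) hj
  refine Corr.of_forall_proj (x := t • ⟨x, hj⟩) (y := t • ⟨y, hy j⟩) fun i => ?_
  refine ((S.proj ((extendIdx.obj j).obj i)).map_smul t ⟨y, hy i⟩).trans ?_
  rw [hyf, ← map_smul, ← map_smul]
  rfl

variable (R S) in
theorem exists_corr (f : X ⟶ Y) (x : V) : ∃ y, R.Corr S f x y := by
  obtain ⟨j, hj⟩ := R.isTateFiltration.exists_mem x
  obtain ⟨y, hy⟩ := S.exists_proj_eq
    (fun i => (f.app ((extendIdx.obj j).obj i)).hom.hom (R.proj _ ⟨x, hj⟩)) fun i i' a => by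
      refine (congrArg (fun g => g.hom.hom (R.proj _ ⟨x, hj⟩))
        (f.naturality ((extendIdx.obj j).map a))).symm.trans ?_
      exact congrArg (f.app _).hom.hom (R.map_proj _ _)
  exact ⟨y, Corr.of_forall_proj (x := ⟨x, hj⟩) hy⟩

variable (R S) in
theorem exists_compat (f : X ⟶ Y) : ∃ T : V ⟶ W, R.Compat S f T := by
  choose T hT using R.exists_corr S f
  let T' : V →ₗ[k] W :=
    { toFun := T
      map_add' := fun x y => (hT _).unique ((hT x).add (hT y))
      map_smul' := fun t x => (hT _).unique ((hT x).smul t) }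
  have hcont : Continuous T' := by
    refine continuous_of_continuousAt_zero T' ?_
    rw [ContinuousAt, map_zero, R.isTateFiltration.hasBasis.tendsto_iff S.isTateFiltration.hasBasis]
    exact fun j _ => ⟨j, trivial, fun x hx => (hT x (TateIdx.mk j j le_rfl) hx).1⟩
  exact ⟨ConcreteCategory.ofHom (C := TopModuleCat k) ⟨T', hcont⟩, hT⟩

theorem Compat.unique {f : X ⟶ Y} {T T' : V ⟶ W} (h : R.Compat S f T) (h' : R.Compat S f T') :
    T = T' :=
  ConcreteCategory.hom_ext _ _ fun x => (h x).unique (h' x)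

theorem Compat.comp {f : X ⟶ Y} {g : Y ⟶ Z} {T : V ⟶ W} {T' : W ⟶ U} (h : R.Compat S f T)
    (h' : S.Compat Q g T') : R.Compat Q (f ≫ g) (T ≫ T') := by
  intro x q hx
  obtain ⟨hTx, hT⟩ := h x q hx
  obtain ⟨hT'x, hT'⟩ := h' _ q hTx
  exact ⟨hT'x, hT'.trans (by rw [hT]; rfl)⟩

theorem Compat.injective {f f' : X ⟶ Y} {T : V ⟶ W} (h : R.Compat S f T) (h' : R.Compat S f' T) :
    f = f' := by
  ext q : 2
  refine FGModuleCat.hom_ext (LinearMap.ext fun y => ?_)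
  obtain ⟨x, rfl⟩ := R.proj_surjective q y
  obtain ⟨_, hf⟩ := h x q x.2
  obtain ⟨_, hf'⟩ := h' x q x.2
  exact hf.symm.trans hf'

variable (R S)

theorem compat_id : R.Compat R (𝟙 X) (𝟙 V) := fun _ _ hx => ⟨hx, rfl⟩

theorem exists_iso (S : TateRealization X W) :
    ∃ e : V ≅ W, R.Compat S (𝟙 X) e.hom ∧ S.Compat R (𝟙 X) e.inv := by
  obtain ⟨T, hT⟩ := R.exists_compat S (𝟙 X)
  obtain ⟨T', hT'⟩ := S.exists_compat R (𝟙 X)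
  have hTT' := hT.comp hT'
  have hT'T := hT'.comp hT
  rw [Category.comp_id] at hTT' hT'T
  exact ⟨⟨T, T', hTT'.unique R.compat_id, hT'T.unique S.compat_id⟩, hT, hT'⟩

theorem exists_hom_compat (T : V ⟶ W) (hT : ∀ j, ∀ x ∈ R.L j, T.hom x ∈ S.L j) :
    ∃ f : X ⟶ Y, R.Compat S f T := by
  choose s hs using fun q => (R.proj q).exists_rightInverse_of_surjective
    (LinearMap.range_eq_top.2 (R.proj_surjective q))
  let g q : X.obj q →ₗ[k] Y.obj q := S.proj q ∘ₗ T.hom.toLinearMap.restrict (hT q.1.2) ∘ₗ s q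
  have hg q (x : R.L q.1.2) : g q (R.proj q x) = S.proj q ⟨T.hom x, hT _ _ x.2⟩ := by
    refine (S.proj_eq_iff q _ _).2 ?_
    have hsx : (s q (R.proj q x) : V) - x ∈ R.L q.1.1 :=
      (R.proj_eq_iff q _ _).1 (LinearMap.congr_fun (hs q) _)
    exact (map_sub T.hom _ _).symm ▸ hT _ _ hsx
  refine ⟨{ app := fun q => FGModuleCat.ofHom (g q), naturality := fun q q' a => ?_ },
    fun x q hx => ⟨hT _ _ hx, (hg q ⟨x, hx⟩).symm⟩⟩
  refine FGModuleCat.hom_ext (LinearMap.ext fun y => ?_)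
  obtain ⟨x, rfl⟩ := R.proj_surjective q y
  change g q' ((X.map a).hom.hom (R.proj q x)) = (Y.map a).hom.hom (g q (R.proj q x))
  rw [R.map_proj, hg, hg, S.map_proj]

/-- The realization of `X ∘ φ̃` induced by a realization of `X`. -/
noncomputable def reindex (φ : Bicofinal) : TateRealization (φ.tilde ⋙ X) V where
  L n := R.L (φ.toFun n)
  isTateFiltration := R.isTateFiltration.comp φ
  proj q := R.proj (φ.tilde.obj q)
  proj_surjective _ := R.proj_surjective _
  proj_eq_zero_iff q x := R.proj_eq_zero_iff (φ.tilde.obj q) x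
  map_proj f x := R.map_proj (φ.tilde.map f) x

theorem isOpen_ker_proj (q : TateIdx) : IsOpen ((R.proj q).ker : Set (R.L q.1.2)) := by
  rw [show ((R.proj q).ker : Set (R.L q.1.2)) = Subtype.val ⁻¹' (R.L q.1.1 : Set V) from
    Set.ext fun x => R.proj_eq_zero_iff q x]
  exact (R.isTateFiltration.isOpen q.1.1).preimage continuous_subtype_val

section

variable [DiscreteTopology k]

/-- The step `L j` of the filtration as a cone over the spaces `X i j`. -/
noncomputable def cone (j : ℤ) : Cone ((extendIdx.obj j ⋙ X) ⋙ discreteFunctor k) where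
  pt := TopModuleCat.of k (R.L j)
  π :=
    { app := fun i => discreteFunctor.ofLin (X := TopModuleCat.of k (R.L j))
        (R.proj ((extendIdx.obj j).obj i)) (R.isOpen_ker_proj _)
      naturality := fun _ _ f => ConcreteCategory.hom_ext _ _ fun x : R.L j =>
        (R.map_proj ((extendIdx.obj j).map f) x).symm }

theorem nonempty_isLimit_cone (j : ℤ) : Nonempty (IsLimit (R.cone j)) := by
  refine (discreteFunctor.nonempty_isLimit_iff _).2 ⟨?_, fun e he => ?_⟩
  · have hbasis : (𝓝 (0 : R.L j)).HasBasis (fun _ => True)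
        fun i => Subtype.val ⁻¹' (R.L (min i j) : Set V) := by
      rw [nhds_subtype]
      refine (R.isTateFiltration.hasBasis.comap _).to_hasBasis ?_ ?_
      · exact fun i _ => ⟨i, trivial, Set.preimage_mono (R.mono (min_le_left i j))⟩
      · exact fun i _ => ⟨min i j, trivial, subset_rfl⟩
    refine hbasis.eq_iInf.trans (iInf_congr fun i => congrArg Filter.principal ?_)
    exact Set.ext fun x => (R.proj_eq_zero_iff ((extendIdx.obj j).obj i) x).symm
  · obtain ⟨x, hx⟩ := R.exists_proj_eq e he
    exact ⟨x, hx, fun y hy => R.ext_of_proj fun i => (hy i).trans (hx i).symm⟩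

theorem isLinearlyCompact (j : ℤ) : IsLinearlyCompact k (R.L j) :=
  discreteFunctor.limit_isLinearlyCompact (R.nonempty_isLimit_cone j).some

include R in
theorem countableLLC : countableLLCProp k V :=
  ⟨⟨R.isTateFiltration.t2Space, .mk_of_hasBasis k R.isTateFiltration.hasBasis,
    R.L 0, R.isTateFiltration.isOpen 0, R.isLinearlyCompact 0⟩,
    R.isTateFiltration.hasBasis.isCountablyGenerated,
    fun n : ℕ => R.L n, fun n => ⟨R.isTateFiltration.isOpen n, R.isLinearlyCompact n⟩, fun x =>
      let ⟨j, hj⟩ := R.isTateFiltration.exists_mem x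
      ⟨j.toNat, R.mono (Int.self_le_toNat j) hj⟩⟩

end

end TateRealization

end TateRealizations

section Colimits

variable {k : Type (max w u)} [Field k] [TopologicalSpace k] {J : Type w} [SmallCategory J]
  {F : J ⥤ TopModuleCat.{max w u} k} {c : Cocone F}

theorem isColimit_exists_rep [IsFiltered J] (hc : IsColimit c) (x : c.pt) :
    ∃ j y, (c.ι.app j).hom y = x := by
  have : PreservesFilteredColimitsOfSize.{w, w} (forget (ModuleCat.{max w u} k)) :=
    preservesFilteredColimitsOfSize_shrink.{w, max w u, w, max w u} _
  exact Concrete.isColimit_exists_rep _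
    (isColimitOfPreserves (forget₂ (TopModuleCat.{max w u} k) (ModuleCat.{max w u} k)) hc) x

theorem isColimit_injective [IsFiltered J] (hc : IsColimit c)
    (hF : ∀ ⦃i j : J⦄ (f : i ⟶ j), Function.Injective (F.map f).hom) (j : J) :
    Function.Injective (c.ι.app j).hom := by
  have : PreservesFilteredColimitsOfSize.{w, w} (forget (ModuleCat.{max w u} k)) :=
    preservesFilteredColimitsOfSize_shrink.{w, max w u, w, max w u} _
  intro x y hxy
  obtain ⟨l, f, g, hfg⟩ := Concrete.isColimit_exists_of_rep_eq _
    (isColimitOfPreserves (forget₂ (TopModuleCat.{max w u} k) (ModuleCat.{max w u} k)) hc) x y hxy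
  refine hF (f ≫ IsFiltered.coeqHom f g) (Eq.trans ?_
    (congrArg (fun a => (F.map a).hom y) (IsFiltered.coeq_condition f g)).symm)
  rw [F.map_comp, F.map_comp]
  exact congrArg (F.map (IsFiltered.coeqHom f g)).hom hfg

theorem isColimit_isOpen [DiscreteTopology k] (hc : IsColimit c) {U : Submodule k c.pt}
    (hU : ∀ j, IsOpen ((U.comap (c.ι.app j).hom.toLinearMap : Submodule k (F.obj j)) :
      Set (F.obj j))) :
    IsOpen (U : Set c.pt) := by
  let _ : TopologicalSpace (c.pt ⧸ U) := ⊥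
  have : DiscreteTopology (c.pt ⧸ U) := ⟨rfl⟩
  have : ContinuousSMul k (c.pt ⧸ U) := ⟨continuous_of_discreteTopology⟩
  have hcont j : Continuous (U.mkQ ∘ₗ (c.ι.app j).hom.toLinearMap) := by
    refine continuous_of_continuousAt_zero (U.mkQ ∘ₗ (c.ι.app j).hom.toLinearMap) ?_
    rw [ContinuousAt, map_zero, nhds_discrete (c.pt ⧸ U), Filter.tendsto_pure]
    exact Filter.mem_of_superset ((hU j).mem_nhds (zero_mem _))
      fun y hy => (Submodule.Quotient.mk_eq_zero U).2 hy
  let s : Cocone F :=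
    { pt := TopModuleCat.of k (c.pt ⧸ U)
      ι :=
        { app := fun j => ConcreteCategory.ofHom (C := TopModuleCat k)
            (Y := TopModuleCat.of k (c.pt ⧸ U)) ⟨U.mkQ ∘ₗ (c.ι.app j).hom.toLinearMap, hcont j⟩
          naturality := fun j j' f => ConcreteCategory.hom_ext _ _ fun y =>
            congrArg (fun g => U.mkQ (g.hom y)) (c.w f) } }
  have hdesc : (hc.desc s).hom.toLinearMap = U.mkQ :=
    congrArg ModuleCat.Hom.hom <| (isColimitOfPreserves
      (forget₂ (TopModuleCat.{max w u} k) (ModuleCat.{max w u} k)) hc).hom_ext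
      (f' := ModuleCat.ofHom U.mkQ) (f := ModuleCat.ofHom (hc.desc s).hom.toLinearMap) fun j =>
        congrArg (forget₂ (TopModuleCat k) (ModuleCat k)).map (hc.fac s j)
  rw [← U.ker_mkQ, ← hdesc]
  exact (isOpen_discrete {(0 : c.pt ⧸ U)}).preimage (hc.desc s).hom.continuous

end Colimits

section IndProLimit

variable {k : Type u} [Field k] [TopologicalSpace k] [DiscreteTopology k]

variable (k) in
/-- The functor sending `X` to the projective limits `lim_i X_{ij}`, for `j : ℤ`. -/
noncomputable def proLim : (TateIdx ⥤ FGModuleCat.{u} k) ⥤ ℤ ⥤ TopModuleCat.{u} k :=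
  (Functor.whiskeringRight _ _ _).obj (discreteFunctor k) ⋙
    Functor.whiskeringRight ℤ TateIdx (TopModuleCat.{u} k) ⋙
    (Functor.whiskeringLeft ℤ (ℤ ⥤ TateIdx) (ℤ ⥤ TopModuleCat.{u} k)).obj extendIdx ⋙
    (Functor.whiskeringRight ℤ (ℤ ⥤ TopModuleCat.{u} k) (TopModuleCat.{u} k)).obj lim

namespace proLim

variable (X : TateIdx ⥤ FGModuleCat.{u} k)

/-- The limit cone of `lim_i X_{ij}`. -/
noncomputable def cone (j : ℤ) : Cone ((extendIdx.obj j ⋙ X) ⋙ discreteFunctor k) :=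
  limit.cone _

noncomputable def isLimitCone (j : ℤ) : IsLimit (cone X j) :=
  limit.isLimit _

/-- The projection from `lim_i X_{ij}` to `X_{ij}`, to `X_{jj}` if `j < i`. -/
noncomputable def π (j i : ℤ) :
    ((proLim k).obj X).obj j →ₗ[k] X.obj ((extendIdx.obj j).obj i) :=
  discreteFunctor.coneProj (cone X j) i

theorem π_map {j j' : ℤ} (h : j ⟶ j') (i : ℤ) (y : ((proLim k).obj X).obj j) :
    π X j' i ((((proLim k).obj X).map h).hom y) =
      (X.map ((extendIdx.map h).app i)).hom.hom (π X j i y) :=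
  congrArg (fun g => g.hom y) (limMap_π (Functor.whiskerRight (extendIdx.map h)
    (X ⋙ discreteFunctor k)) i)

variable {X} in
theorem π_app {Y} (f : X ⟶ Y) (j i : ℤ) (y : ((proLim k).obj X).obj j) :
    π Y j i ((((proLim k).map f).app j).hom y) = (f.app _).hom.hom (π X j i y) :=
  congrArg (fun g => g.hom y) (limMap_π (Functor.whiskerLeft (extendIdx.obj j)
    (Functor.whiskerRight f (discreteFunctor k))) i)

variable {X}

theorem map_π {j i i' : ℤ} (h : i ⟶ i') (y : ((proLim k).obj X).obj j) :
    (X.map ((extendIdx.obj j).map h)).hom.hom (π X j i y) = π X j i' y :=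
  discreteFunctor.map_coneProj (cone X j) h y

theorem eq_zero_of_forall_le {j : ℤ} (n : ℤ) {y : ((proLim k).obj X).obj j}
    (h : ∀ i ≤ n, π X j i y = 0) : y = 0 := by
  refine discreteFunctor.limit_ext (isLimitCone X j) fun i => ?_
  have hi := map_π (X := X) (homOfLE (min_le_left i n)) y
  rw [h _ (min_le_right i n), map_zero] at hi
  exact hi.symm.trans (map_zero (π X j i)).symm

theorem exists_π_eq {j : ℤ} (e : ∀ i, X.obj ((extendIdx.obj j).obj i))
    (he : ∀ ⦃i i' : ℤ⦄ (h : i ⟶ i'), (X.map ((extendIdx.obj j).map h)).hom.hom (e i) = e i') :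
    ∃ y : ((proLim k).obj X).obj j, ∀ i, π X j i y = e i :=
  discreteFunctor.limit_exists (isLimitCone X j) e he

theorem hasBasis_ker_π (j : ℤ) :
    (𝓝 (0 : ((proLim k).obj X).obj j)).HasBasis (fun _ => True) fun i => ((π X j i).ker : Set _) :=
  discreteFunctor.limit_hasBasis (isLimitCone X j)

theorem isOpen_ker_π (j i : ℤ) : IsOpen ((π X j i).ker : Set (((proLim k).obj X).obj j)) :=
  discreteFunctor.isOpen_ker_coneProj (cone X j) i

variable (hX : IsAdmissibleBiFun _ X)
include hX

theorem π_surjective (j i : ℤ) : Function.Surjective (π X j i) :=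
  discreteFunctor.limit_surjective (isLimitCone X j)
    (fun _ _ f => hX.map_surjective ((extendIdx.obj j).map f) rfl) i

theorem map_injective {j j' : ℤ} (h : j ⟶ j') :
    Function.Injective (((proLim k).obj X).map h).hom := by
  rw [injective_iff_map_eq_zero]
  intro y hy
  refine eq_zero_of_forall_le j fun i hi => hX.map_injective ((extendIdx.map h).app i) ?_ ?_
  · change min i j = min i j'
    rw [min_eq_left hi, min_eq_left (hi.trans (leOfHom h))]
  · rw [← π_map, hy, map_zero, map_zero]

theorem π_map_eq_zero {j j' : ℤ} (h : j ⟶ j') (z : ((proLim k).obj X).obj j) :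
    π X j' j ((((proLim k).obj X).map h).hom z) = 0 := by
  rw [π_map, hX.eq_zero (min_self j) (π X j j z), map_zero]

theorem exists_map_eq {m j : ℤ} (h : m ⟶ j) (y : ((proLim k).obj X).obj j)
    (hy : π X j m y = 0) : ∃ z, (((proLim k).obj X).map h).hom z = y := by
  have hmin i : min i m = min (min i m) j := by have := leOfHom h; omega
  let f i : (extendIdx.obj m).obj i ⟶ (extendIdx.obj j).obj (min i m) :=
    homOfLE ⟨(hmin i).le, leOfHom h⟩
  let g i := (extendIdx.obj j).map (homOfLE (min_le_right i m))
  choose e he using fun i => (hX.map_eq_zero_iff (f i) (g i) (hmin i)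
    (min_eq_left (leOfHom h)).symm rfl (π X j (min i m) y)).1 ((map_π _ y).trans hy)
  have hcompat ⦃i i' : ℤ⦄ (a : i ⟶ i') :
      (X.map ((extendIdx.obj m).map a)).hom.hom (e i) = e i' := by
    refine hX.map_injective (f i') (hmin i') ?_
    rw [he, ← map_π (homOfLE (min_le_min_right m (leOfHom a))) y, ← he i]
    rw [TateIdx.map_map X _ _ (f i ≫ (extendIdx.obj j).map (homOfLE
      (min_le_min_right m (leOfHom a)))), TateIdx.map_map X]
  obtain ⟨z, hz⟩ := exists_π_eq e hcompat
  refine ⟨z, sub_eq_zero.1 (eq_zero_of_forall_le m fun i _ => ?_)⟩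
  rw [map_sub, sub_eq_zero, π_map, hz, ← map_π (homOfLE (min_le_left i m)) y, ← he i,
    TateIdx.map_map X]

end proLim

namespace indProLim

open proLim

variable (X : TateIdx ⥤ FGModuleCat.{u} k)

/-- The canonical morphism from `lim_i X_{ij}` to `colim_j lim_i X_{ij}`. -/
noncomputable def ι (j : ℤ) : ((proLim k).obj X).obj j ⟶ (indProLim k).obj X :=
  colimit.ι ((proLim k).obj X) j

theorem ι_map {j j' : ℤ} (h : j ⟶ j') (y : ((proLim k).obj X).obj j) :
    (ι X j').hom ((((proLim k).obj X).map h).hom y) = (ι X j).hom y :=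
  congrArg (fun g => g.hom y) (colimit.w ((proLim k).obj X) h)

variable {X} in
theorem map_ι {Y} (f : X ⟶ Y) (j : ℤ) (y : ((proLim k).obj X).obj j) :
    ((indProLim k).map f).hom ((ι X j).hom y) = (ι Y j).hom ((((proLim k).map f).app j).hom y) :=
  congrArg (fun g => g.hom y) (ι_colimMap ((proLim k).map f) j)

theorem exists_ι_eq (x : (indProLim k).obj X) : ∃ j y, (ι X j).hom y = x :=
  isColimit_exists_rep.{u, 0} (colimit.isColimit ((proLim k).obj X)) x

/-- The image of `lim_i X_{ij}` in `colim_j lim_i X_{ij}`. -/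
noncomputable def filtration (j : ℤ) : Submodule k ((indProLim k).obj X) :=
  (ι X j).hom.toLinearMap.range

theorem filtration_mono : Monotone (filtration X) := by
  rintro j j' h _ ⟨y, rfl⟩
  exact ⟨_, ι_map X (homOfLE h) y⟩

variable {X} (hX : IsAdmissibleBiFun _ X)
include hX

theorem ι_injective (j : ℤ) : Function.Injective (ι X j).hom :=
  isColimit_injective.{u, 0} (colimit.isColimit ((proLim k).obj X))
    (fun _ _ f => map_injective hX f) j

theorem ι_mem_filtration_iff {j i : ℤ} (y : ((proLim k).obj X).obj j) :
    (ι X j).hom y ∈ filtration X i ↔ π X j i y = 0 := by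
  obtain hij | hji := le_total i j
  · constructor
    · rintro ⟨z, hz⟩
      obtain rfl : (((proLim k).obj X).map (homOfLE hij)).hom z = y :=
        ι_injective hX j ((ι_map X _ z).trans hz)
      exact π_map_eq_zero hX _ z
    · intro h
      obtain ⟨z, rfl⟩ := exists_map_eq hX (homOfLE hij) y h
      exact ⟨z, (ι_map X _ z).symm⟩
  · exact ⟨fun _ => hX.eq_zero (min_eq_right hji) _, fun _ => filtration_mono X hji ⟨y, rfl⟩⟩

theorem isOpen_filtration (m : ℤ) : IsOpen (filtration X m : Set ((indProLim k).obj X)) := by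
  refine isColimit_isOpen.{u, 0} (colimit.isColimit ((proLim k).obj X)) fun j => ?_
  exact (congrArg IsOpen (Set.ext (ι_mem_filtration_iff hX))).mpr (isOpen_ker_π j m)

theorem exists_filtration_subset {U : Set ((indProLim k).obj X)} (hU : U ∈ 𝓝 0) :
    ∃ j, (filtration X j : Set ((indProLim k).obj X)) ⊆ U := by
  have hpre : (ι X 0).hom ⁻¹' U ∈ 𝓝 0 :=
    (ι X 0).hom.continuous.continuousAt.preimage_mem_nhds (by rwa [map_zero])
  obtain ⟨i, -, hi⟩ := (hasBasis_ker_π 0).mem_iff.1 hpre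
  refine ⟨min i 0, fun x hx => ?_⟩
  obtain ⟨y, rfl⟩ := filtration_mono X (min_le_right i 0) hx
  exact hi ((ι_mem_filtration_iff hX y).1 (filtration_mono X (min_le_left i 0) hx))

theorem filtration_complete (v : ℤ → (indProLim k).obj X)
    (hv : ∀ i i', i ≤ i' → v i - v i' ∈ filtration X i') : ∃ x, ∀ i, x - v i ∈ filtration X i := by
  obtain ⟨j, hj0, hj⟩ : ∃ j, 0 ≤ j ∧ v 0 ∈ filtration X j := by
    obtain ⟨j, y, hy⟩ := exists_ι_eq X (v 0)
    exact ⟨max j 0, le_max_right _ _, filtration_mono X (le_max_left _ _) ⟨y, hy⟩⟩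
  have hmem i : v (min i 0) ∈ filtration X j := by
    simpa using add_mem (filtration_mono X hj0 (hv _ _ (min_le_right i 0))) hj
  choose y hy using show ∀ i, ∃ y, (ι X j).hom y = v (min i 0) from hmem
  obtain ⟨z, hz⟩ := exists_π_eq (X := X) (fun i => π X j i (y i)) fun i i' h => by
    rw [map_π h, ← sub_eq_zero, ← map_sub, ← ι_mem_filtration_iff hX, map_sub, hy, hy]
    exact filtration_mono X (min_le_left _ _) (hv _ _ (min_le_min_right 0 (leOfHom h)))
  refine ⟨(ι X j).hom z, fun i => ?_⟩
  have hzv : (ι X j).hom z - v (min i 0) ∈ filtration X i := by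
    rw [← hy, ← map_sub, ι_mem_filtration_iff hX, map_sub, hz, sub_self]
  simpa using add_mem hzv (hv _ _ (min_le_left i 0))

theorem isTateFiltration : IsTateFiltration (filtration X) where
  mono := filtration_mono X
  isOpen := isOpen_filtration hX
  exists_le _ := exists_filtration_subset hX
  exists_mem x := by
    obtain ⟨j, y, hy⟩ := exists_ι_eq X x
    exact ⟨j, y, hy⟩
  separated x hx := by
    obtain ⟨y, rfl⟩ := hx 0
    rw [eq_zero_of_forall_le (X := X) (y := y) 0 fun i _ =>
      (ι_mem_filtration_iff hX y).1 (hx i), map_zero]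
  complete := filtration_complete hX

/-- The morphism of `Π` from `(min i j, j)` to `(i, j)`. -/
noncomputable def fromExtend (q : TateIdx) : (extendIdx.obj q.1.2).obj q.1.1 ⟶ q :=
  homOfLE ⟨min_le_left _ _, le_rfl⟩

/-- The projection to `X_{ij}` of the image of `lim_i X_{ij}`. -/
noncomputable def proj (q : TateIdx) : filtration X q.1.2 →ₗ[k] X.obj q :=
  (X.map (fromExtend q)).hom.hom ∘ₗ π X q.1.2 q.1.1 ∘ₗ
    (LinearEquiv.ofInjective (ι X q.1.2).hom.toLinearMap (ι_injective hX q.1.2)).symm.toLinearMap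

theorem proj_ι (q : TateIdx) (y : ((proLim k).obj X).obj q.1.2)
    (h : (ι X q.1.2).hom y ∈ filtration X q.1.2) :
    proj hX q ⟨(ι X q.1.2).hom y, h⟩ = (X.map (fromExtend q)).hom.hom (π X q.1.2 q.1.1 y) := by
  have hy : (LinearEquiv.ofInjective (ι X q.1.2).hom.toLinearMap (ι_injective hX q.1.2)).symm
      ⟨(ι X q.1.2).hom y, h⟩ = y := by
    rw [LinearEquiv.symm_apply_eq]
    rfl
  exact congrArg (fun z => (X.map (fromExtend q)).hom.hom (π X q.1.2 q.1.1 z)) hy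

/-- The canonical realization of an admissible functor `X` by `colim_j lim_i X_{ij}`. -/
noncomputable def realization : TateRealization X ((indProLim k).obj X) where
  L := filtration X
  isTateFiltration := isTateFiltration hX
  proj := proj hX
  proj_surjective q e := by
    obtain ⟨e', rfl⟩ := hX.map_surjective (fromExtend q) rfl e
    obtain ⟨y, rfl⟩ := π_surjective hX q.1.2 q.1.1 e'
    exact ⟨_, proj_ι hX q y ⟨y, rfl⟩⟩
  proj_eq_zero_iff := by
    rintro q ⟨_, y, rfl⟩
    refine (Eq.congr_left (proj_ι hX q y ⟨y, rfl⟩)).trans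
      (Iff.trans ?_ (ι_mem_filtration_iff hX y).symm)
    exact map_eq_zero_iff _ (hX.map_injective (fromExtend q) (min_eq_left q.2))
  map_proj := by
    rintro q q' f ⟨_, y, rfl⟩
    let y' := (((proLim k).obj X).map (homOfLE (leOfHom f).2)).hom y
    have hy' : (⟨_, y', rfl⟩ : filtration X q'.1.2) =
      ⟨(ι X q.1.2).hom y, filtration_mono X (leOfHom f).2 ⟨y, rfl⟩⟩ := Subtype.ext (ι_map X _ y)
    refine (congrArg _ (proj_ι hX q y ⟨y, rfl⟩)).trans (Eq.trans ?_
      ((proj_ι hX q' y' ⟨y', rfl⟩).symm.trans (congrArg _ hy')))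
    rw [π_map, ← map_π (homOfLE (leOfHom f).1), TateIdx.map_map X _ _ (fromExtend q ≫ f),
      TateIdx.map_map X _ _ ((extendIdx.obj _).map (homOfLE (leOfHom f).1) ≫
        (extendIdx.map (homOfLE (leOfHom f).2)).app _), TateIdx.map_map X]

theorem compat_map {Y} (hY : IsAdmissibleBiFun _ Y) (f : X ⟶ Y) :
    (realization hX).Compat (realization hY) f ((indProLim k).map f) := by
  rintro _ q ⟨y, rfl⟩
  let y' := (((proLim k).map f).app q.1.2).hom y
  have hy' : ((indProLim k).map f).hom ((ι X q.1.2).hom y) = (ι Y q.1.2).hom y' := map_ι f q.1.2 y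
  refine ⟨⟨y', hy'.symm⟩, ?_⟩
  refine (congrArg (proj hY q) (Subtype.ext hy' : (⟨_, ⟨y', hy'.symm⟩⟩ : filtration Y q.1.2) =
    ⟨_, ⟨y', rfl⟩⟩)).trans ((proj_ι hY q y' _).trans (Eq.trans ?_
      (congrArg (f.app q).hom.hom (proj_ι hX q y ⟨y, rfl⟩)).symm))
  rw [π_app]
  exact congrArg (fun g => g.hom.hom (π X q.1.2 q.1.1 y)) (f.naturality (fromExtend q)).symm

end indProLim

end IndProLimit

section ExistenceOfRealizations

theorem finite_quotient_submoduleOf_iff {R V : Type*} [Ring R] [AddCommGroup V] [Module R V]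
    {A B : Submodule R V} : Module.Finite R (A ⧸ B.submoduleOf A) ↔ (A.map B.mkQ).FG := by
  have hker : (B.mkQ ∘ₗ A.subtype).ker = B.submoduleOf A := by
    rw [LinearMap.ker_comp, B.ker_mkQ]
    rfl
  have hrange : (B.mkQ ∘ₗ A.subtype).range = A.map B.mkQ := by
    rw [LinearMap.range_comp, A.range_subtype]
  rw [← hker, ← hrange, ← Module.Finite.iff_fg]
  exact Module.Finite.equiv_iff (LinearMap.quotKerEquivRange _)

section

variable {k V : Type*} [Field k] [AddCommGroup V] [Module k V] [TopologicalSpace V]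
  [IsTopologicalAddGroup V]

theorem IsLinearlyCompact.map_mkQ_fg {U B : Submodule k V} (hU : IsLinearlyCompact k U)
    (hB : IsOpen (B : Set V)) : (U.map B.mkQ).FG :=
  finite_quotient_submoduleOf_iff.1 <|
    hU.finite_quotient (U := B.submoduleOf U) (hB.preimage continuous_subtype_val)

theorem partialSups_map_mkQ_fg {U : ℕ → Submodule k V} (hU : ∀ n, IsLinearlyCompact k (U n))
    {B : Submodule k V} (hB : IsOpen (B : Set V)) (n : ℕ) :
    ((partialSups U n).map B.mkQ).FG := by
  induction n with
  | zero => exact (hU 0).map_mkQ_fg hB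
  | succ n ih =>
    rw [partialSups_add_one, Submodule.map_sup]
    exact ih.sup ((hU (n + 1)).map_mkQ_fg hB)

theorem IsTateFiltration.of_isLinearlyCompact [T2Space V] {L : ℤ → Submodule k V}
    (hL : Monotone L) (hopen : ∀ j, IsOpen (L j : Set V))
    (hle : ∀ U ∈ 𝓝 (0 : V), ∃ j, (L j : Set V) ⊆ U) (hmem : ∀ x, ∃ j, x ∈ L j) {m : ℤ}
    (hm : IsLinearlyCompact k (L m)) : IsTateFiltration L := by
  refine ⟨hL, hopen, hle, hmem, fun x hx => ?_, fun v hv => ?_⟩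
  · by_contra hne
    obtain ⟨j, hj⟩ := hle {x}ᶜ (isOpen_compl_singleton.mem_nhds (Ne.symm hne))
    exact hj (hx j) rfl
  · let u i : L m := ⟨v (min i m) - v m, hv _ _ (min_le_right i m)⟩
    have hu {l i : ℤ} (h : l ≤ i) : u l - u i ∈ (L (min i m)).submoduleOf (L m) := by
      change v (min l m) - v m - (v (min i m) - v m) ∈ L (min i m)
      rw [sub_sub_sub_cancel_right]
      exact hv _ _ (min_le_min_right m h)
    obtain ⟨y, hy⟩ := hm.exists_forall_sub_mem
      (fun i => (hopen (min i m)).preimage continuous_subtype_val) u fun S => by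
        obtain ⟨l, hl⟩ := S.bddBelow
        exact ⟨u l, fun i hi => hu (hl hi)⟩
    refine ⟨y + v m, fun i => ?_⟩
    have hyi : (y : V) - (v (min i m) - v m) ∈ L (min i m) := hy i
    have hyv := add_mem (hL (min_le_left i m) hyi) (hv _ _ (min_le_left i m))
    rwa [show (y : V) - (v (min i m) - v m) + (v (min i m) - v i) = y + v m - v i by abel] at hyv

theorem exists_isTateFiltration (hV : IsLocallyLinearlyCompact k V) (hV' : IsOfCountableType k V) :
    ∃ L : ℤ → Submodule k V, IsTateFiltration L ∧
      ∀ i j, Module.Finite k (L j ⧸ (L i).submoduleOf (L j)) := by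
  have := hV.t2
  have := hV.linear
  have := hV'.countable_nhds
  obtain ⟨W, hW, hWbasis⟩ :=
    (IsLinearTopology.hasBasis_open_submodule k (M := V)).exists_antitone_subbasis
  obtain ⟨U, hU, hUx⟩ := hV'.exists_cover
  let A := partialSups U
  have hAopen n : IsOpen (A n : Set V) :=
    Submodule.isOpen_mono (le_partialSups_of_le U n.zero_le) (hU 0).1
  let L (j : ℤ) : Submodule k V := if 0 ≤ j then A j.toNat else U 0 ⊓ W (-j).toNat
  have hLA j : L j ≤ A j.toNat := by
    unfold L
    split_ifs
    · exact le_rfl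
    · exact inf_le_left.trans (le_partialSups_of_le U (Nat.zero_le _))
  have hLopen j : IsOpen (L j : Set V) := by
    unfold L
    split_ifs
    · exact hAopen _
    · exact (hU 0).1.inter (hW _)
  have hLmono : Monotone L := by
    intro i j hij
    by_cases hj : 0 ≤ j
    · exact (hLA i).trans ((A.monotone (by omega)).trans (if_pos hj).ge)
    · simp only [L, if_neg hj, if_neg (fun hi : 0 ≤ i => hj (hi.trans hij))]
      exact inf_le_inf_left _ (hWbasis.antitone (by omega))
  have hL0 : IsLinearlyCompact k (L 0) := (hU 0).2
  refine ⟨L, .of_isLinearlyCompact hLmono hLopen (fun N hN => ?_) (fun x => ?_) hL0,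
    fun i j => ?_⟩
  · obtain ⟨n, hn⟩ := hWbasis.mem_iff.1 hN
    have hneg : ¬ 0 ≤ -(n + 1 : ℤ) := by omega
    refine ⟨-(n + 1), fun x hx => hn (hWbasis.antitone n.le_succ ?_)⟩
    simp only [L, if_neg hneg] at hx
    simpa using hx.2
  · obtain ⟨n, hn⟩ := hUx x
    exact ⟨n, by simpa [L] using le_partialSups U n hn⟩
  · exact finite_quotient_submoduleOf_iff.2
      ((partialSups_map_mkQ_fg (fun n => (hU n).2) (hLopen i) j.toNat).of_le
        (Submodule.map_mono (hLA j)))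

end

section

variable {k V : Type u} [Field k] [AddCommGroup V] [Module k V]

/-- The functor `(i, j) ↦ L j / L i` attached to an increasing filtration `L` with
finite-dimensional subquotients. -/
def filtrationQuotient {L : ℤ → Submodule k V} (hL : Monotone L)
    (hfin : ∀ i j, Module.Finite k (L j ⧸ (L i).submoduleOf (L j))) :
    TateIdx ⥤ FGModuleCat.{u} k where
  obj q := ⟨ModuleCat.of k (L q.1.2 ⧸ (L q.1.1).submoduleOf (L q.1.2)), hfin _ _⟩
  map f := ObjectProperty.homMk (ModuleCat.ofHom
    (Submodule.mapQ _ _ (Submodule.inclusion (hL (leOfHom f).2)) fun _ hx => hL (leOfHom f).1 hx))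
  map_id _ := FGModuleCat.hom_ext <| LinearMap.ext <| (Submodule.mkQ_surjective _).forall.2
    fun _ => rfl
  map_comp _ _ := FGModuleCat.hom_ext <| LinearMap.ext <| (Submodule.mkQ_surjective _).forall.2
    fun _ => rfl

theorem mkQ_submoduleOf_eq_zero_iff {R M : Type*} [Ring R] [AddCommGroup M] [Module R M]
    {A B : Submodule R M} (x : B) : (A.submoduleOf B).mkQ x = 0 ↔ (x : M) ∈ A :=
  Submodule.Quotient.mk_eq_zero _

theorem isAdmissible_filtrationQuotient {L : ℤ → Submodule k V} (hL : Monotone L)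
    (hfin : ∀ i j, Module.Finite k (L j ⧸ (L i).submoduleOf (L j))) :
    IsAdmissibleBiFun _ (filtrationQuotient hL hfin) := by
  intro i j l hij hjl
  refine ⟨FGModuleCat.hom_ext <| LinearMap.ext <| (Submodule.mkQ_surjective _).forall.2 fun x => ?_,
    fgModuleCat_shortExact_iff.2 ⟨?_, ?_, (Submodule.mkQ_surjective _).forall.2 fun x hx => ?_⟩⟩
  · exact (mkQ_submoduleOf_eq_zero_iff (A := L j) (B := L l) ⟨x, hL hjl x.2⟩).2 x.2
  · refine (injective_iff_map_eq_zero _).2 <| (Submodule.mkQ_surjective _).forall.2 fun x hx => ?_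
    exact (mkQ_submoduleOf_eq_zero_iff (A := L i) (B := L j) x).2
      ((mkQ_submoduleOf_eq_zero_iff (A := L i) (B := L l) ⟨x, hL hjl x.2⟩).1 hx)
  · exact (Submodule.mkQ_surjective _).forall.2 fun x => ⟨((L i).submoduleOf (L l)).mkQ x, rfl⟩
  · have hxj : (x : V) ∈ L j := (mkQ_submoduleOf_eq_zero_iff (A := L j) (B := L l) x).1 hx
    exact ⟨((L i).submoduleOf (L j)).mkQ ⟨x, hxj⟩, rfl⟩

end

section

variable {k : Type u} [Field k] [TopologicalSpace k] (V : TopModuleCat.{u} k)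

/-- The realization by `V` of the subquotients of a Tate filtration of `V`. -/
noncomputable def TateRealization.ofFiltration {L : ℤ → Submodule k V} (hL : IsTateFiltration L)
    (hfin : ∀ i j, Module.Finite k (L j ⧸ (L i).submoduleOf (L j))) :
    TateRealization (filtrationQuotient hL.mono hfin) V where
  L := L
  isTateFiltration := hL
  proj q := ((L q.1.1).submoduleOf (L q.1.2)).mkQ
  proj_surjective _ := Submodule.mkQ_surjective _
  proj_eq_zero_iff _ := mkQ_submoduleOf_eq_zero_iff
  map_proj _ _ := rfl

theorem exists_tateRealization (hV : countableLLCProp k V) :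
    ∃ X, IsAdmissibleBiFun _ X ∧ Nonempty (TateRealization X V) := by
  obtain ⟨L, hL, hfin⟩ := exists_isTateFiltration hV.1 hV.2
  exact ⟨_, isAdmissible_filtrationQuotient hL.mono hfin, ⟨.ofFiltration V hL hfin⟩⟩

end

end ExistenceOfRealizations

section Roofs

theorem Bicofinal.exists_of_rel (R : ℤ → ℤ → Prop)
    (hR : ∀ {m m' n n'}, m' ≤ m → n ≤ n' → R m n → R m' n') (hleft : ∀ n, ∃ m, R m n)
    (hright : ∀ m, ∃ n, R m n) :
    ∃ φ : Bicofinal, (∀ n, φ.toFun n ≤ n) ∧ ∀ n, R (φ.toFun n) n := by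
  have hgreatest n : ∃ m, (m ≤ n ∧ R m n) ∧ ∀ z, z ≤ n ∧ R z n → z ≤ m := by
    refine Int.exists_greatest_of_bdd ⟨n, fun _ hz => hz.1⟩ ?_
    obtain ⟨m, hm⟩ := hleft n
    exact ⟨min m n, min_le_right _ _, hR (min_le_left _ _) le_rfl hm⟩
  choose f hf hmax using hgreatest
  refine ⟨⟨⟨f, fun n n' h => hmax n' _ ⟨(hf n).1.trans h, hR le_rfl h (hf n).2⟩⟩,
    Filter.tendsto_atBot_mono (fun n => (hf n).1) Filter.tendsto_id, ?_⟩,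
    fun n => (hf n).1, fun n => (hf n).2⟩
  refine Filter.tendsto_atTop.2 fun b => ?_
  obtain ⟨n, hn⟩ := hright b
  filter_upwards [Filter.eventually_ge_atTop (max b n)] with n' hn'
  exact hmax n' b ⟨(le_max_left _ _).trans hn', hR le_rfl ((le_max_right _ _).trans hn') hn⟩

/-- The identity of `ℤ` as a bicofinal map. -/
noncomputable def Bicofinal.id : Bicofinal := ⟨OrderHom.id, Filter.tendsto_id, Filter.tendsto_id⟩

/-- The composition `φ ∘ ψ` of bicofinal maps. -/
noncomputable def Bicofinal.comp (φ ψ : Bicofinal) : Bicofinal :=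
  ⟨φ.toOrderHom.comp ψ.toOrderHom, φ.tendsto_atBot.comp ψ.tendsto_atBot,
    φ.tendsto_atTop.comp ψ.tendsto_atTop⟩

theorem Bicofinal.comp_le {φ ψ : Bicofinal} (hφ : ∀ n, φ.toFun n ≤ n) (hψ : ∀ n, ψ.toFun n ≤ n)
    (n : ℤ) : (φ.comp ψ).toFun n ≤ n := (hφ _).trans (hψ n)

namespace AdmBiFun

variable {A : Type u} [Category.{v} A] [HasZeroMorphisms A] {X Y Z : AdmBiFun A}

/-- The morphism `X ∘ φ̃ ⟶ Y ∘ φ̃` induced by a morphism `X ⟶ Y`. -/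
noncomputable def reindexMap (f : X ⟶ Y) (φ : Bicofinal) : X.reindex φ ⟶ Y.reindex φ :=
  ObjectProperty.homMk (φ.tilde.whiskerLeft f.hom)

/-- The canonical morphism `X ∘ φ̃ ⟶ X` for `φ ≤ id`. -/
noncomputable def fromReindex (X : AdmBiFun A) (φ : Bicofinal) (h : ∀ n, φ.toFun n ≤ n) :
    X.reindex φ ⟶ X :=
  X.reindexHom (φ₁ := Bicofinal.id) h

instance (X : AdmBiFun A) (φ : Bicofinal) (h : ∀ n, φ.toFun n ≤ n) :
    IsIso ((beilinsonU A).Q.map (X.fromReindex φ h)) :=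
  (beilinsonU A).Q_inverts _ (BeilinsonU.mk X φ Bicofinal.id h)

theorem reindexMap_fromReindex (f : X ⟶ Y) (φ : Bicofinal) (h : ∀ n, φ.toFun n ≤ n) :
    reindexMap f φ ≫ Y.fromReindex φ h = X.fromReindex φ h ≫ f :=
  ObjectProperty.hom_ext _ <| NatTrans.ext <| funext fun p =>
    (f.hom.naturality (TateIdx.hom (φ.monotone' p.2) p.2 (h p.1.1) (h p.1.2))).symm

theorem reindexHom_comp (X : AdmBiFun A) {φ₀ φ₁ φ₂ : Bicofinal}
    (h : ∀ n, φ₀.toFun n ≤ φ₁.toFun n) (h' : ∀ n, φ₁.toFun n ≤ φ₂.toFun n) :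
    X.reindexHom h ≫ X.reindexHom h' = X.reindexHom fun n => (h n).trans (h' n) :=
  ObjectProperty.hom_ext _ <| NatTrans.ext <| funext fun _ => (X.obj.map_comp _ _).symm

/-- The identity, seen as a morphism from `X ∘ (φ ∘ ψ)~` to `(X ∘ φ̃) ∘ ψ̃`. -/
noncomputable def reindexComp (X : AdmBiFun A) (φ ψ : Bicofinal) :
    X.reindex (φ.comp ψ) ⟶ (X.reindex φ).reindex ψ :=
  𝟙 (X.reindex (φ.comp ψ))

theorem reindexComp_fromReindex (X : AdmBiFun A) (φ ψ : Bicofinal) (hφ : ∀ n, φ.toFun n ≤ n)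
    (hψ : ∀ n, ψ.toFun n ≤ n) :
    X.reindexComp φ ψ ≫ (X.reindex φ).fromReindex ψ hψ ≫ X.fromReindex φ hφ =
      X.fromReindex (φ.comp ψ) (Bicofinal.comp_le hφ hψ) :=
  (Category.id_comp _).trans <|
    ObjectProperty.hom_ext _ <| NatTrans.ext <| funext fun _ => (X.obj.map_comp _ _).symm

/-- The morphism `a` of the Beilinson category is a right fraction `s⁻¹ ≫ f`, where
`s : X ∘ φ̃ ⟶ X` is the canonical morphism for some `φ ≤ id`. -/
def IsRoof (a : (beilinsonU A).Q.obj X ⟶ (beilinsonU A).Q.obj Y) : Prop :=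
  ∃ (φ : Bicofinal) (h : ∀ n, φ.toFun n ≤ n) (f : X.reindex φ ⟶ Y),
    (beilinsonU A).Q.map (X.fromReindex φ h) ≫ a = (beilinsonU A).Q.map f

theorem isRoof_map (f : X ⟶ Y) : IsRoof ((beilinsonU A).Q.map f) :=
  ⟨Bicofinal.id, fun _ => le_rfl, X.fromReindex _ _ ≫ f, ((beilinsonU A).Q.map_comp _ _).symm⟩

theorem IsRoof.comp {a : (beilinsonU A).Q.obj X ⟶ (beilinsonU A).Q.obj Y}
    {b : (beilinsonU A).Q.obj Y ⟶ (beilinsonU A).Q.obj Z} (ha : IsRoof a) (hb : IsRoof b) :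
    IsRoof (a ≫ b) := by
  obtain ⟨φ, hφ, f, hf⟩ := ha
  obtain ⟨ψ, hψ, g, hg⟩ := hb
  refine ⟨φ.comp ψ, Bicofinal.comp_le hφ hψ, X.reindexComp φ ψ ≫ reindexMap f ψ ≫ g, ?_⟩
  rw [← reindexComp_fromReindex X φ ψ hφ hψ]
  simp only [Functor.map_comp, Category.assoc]
  rw [reassoc_of% hf, ← hg, ← Functor.map_comp_assoc _ (reindexMap f ψ), reindexMap_fromReindex,
    Functor.map_comp_assoc]

/-- For `φ₀ ≤ φ₁` there is `ψ ≤ id` with `φ₁ ∘ ψ ≤ φ₀`, so the composite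
`Z ∘ (φ₁ ∘ ψ)~ ⟶ Z ∘ φ̃₀ ⟶ Z ∘ φ̃₁` is a canonical morphism. -/
theorem isRoof_wInv (w : X ⟶ Y) (hw : beilinsonU A w) :
    IsRoof (Localization.Construction.wInv w hw) := by
  obtain ⟨Z, φ₀, φ₁, h⟩ := hw
  obtain ⟨ψ, hψ, hR⟩ := Bicofinal.exists_of_rel (fun m n => φ₁.toFun m ≤ φ₀.toFun n)
    (fun hm hn h => (φ₁.monotone' hm).trans (h.trans (φ₀.monotone' hn)))
    (fun n => φ₁.exists_apply_le _) (fun m => φ₀.exists_le_apply _)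
  have hcomp n : (φ₁.comp ψ).toFun n ≤ φ₀.toFun n := hR n
  let f : (Z.reindex φ₁).reindex ψ ⟶ Z.reindex φ₀ := Z.reindexHom hcomp
  have hf : f ≫ Z.reindexHom h = (Z.reindex φ₁).fromReindex ψ hψ := Z.reindexHom_comp hcomp h
  refine ⟨ψ, hψ, f, ?_⟩
  rw [Iso.comp_inv_eq, ← hf]
  exact (beilinsonU A).Q.map_comp _ _

theorem isRoof (a : (beilinsonU A).Q.obj X ⟶ (beilinsonU A).Q.obj Y) : IsRoof a := by
  let P : MorphismProperty (BeilinsonCat A) := fun B C b =>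
    IsRoof (X := (Localization.Construction.objEquiv _).symm B)
      (Y := (Localization.Construction.objEquiv _).symm C) b
  have : P.IsStableUnderComposition := ⟨fun _ _ ha hb => IsRoof.comp ha hb⟩
  have hP : P = ⊤ := Localization.Construction.morphismProperty_eq_top P
    (fun _ _ f => isRoof_map f) fun _ _ w hw => isRoof_wInv w hw
  exact (hP ▸ trivial : P a)

theorem exists_common_roof (a b : (beilinsonU A).Q.obj X ⟶ (beilinsonU A).Q.obj Y) :
    ∃ (φ : Bicofinal) (h : ∀ n, φ.toFun n ≤ n) (f g : X.reindex φ ⟶ Y),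
      (beilinsonU A).Q.map (X.fromReindex φ h) ≫ a = (beilinsonU A).Q.map f ∧
      (beilinsonU A).Q.map (X.fromReindex φ h) ≫ b = (beilinsonU A).Q.map g := by
  obtain ⟨φ, hφ, f, hf⟩ := isRoof a
  obtain ⟨ψ, hψ, g, hg⟩ := isRoof b
  have hψ_comp n : (φ.comp ψ).toFun n ≤ ψ.toFun n := hφ _
  refine ⟨φ.comp ψ, Bicofinal.comp_le hφ hψ,
    X.reindexComp φ ψ ≫ (X.reindex φ).fromReindex ψ hψ ≫ f, X.reindexHom hψ_comp ≫ g, ?_, ?_⟩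
  · rw [← reindexComp_fromReindex X φ ψ hφ hψ]
    simp only [Functor.map_comp, Category.assoc, hf]
  · rw [Functor.map_comp, ← hg, ← Functor.map_comp_assoc]
    congr 2
    exact (X.reindexHom_comp (φ₂ := Bicofinal.id) hψ_comp hψ).symm

end AdmBiFun

end Roofs

section TateFunctorEquivalence

theorem exists_le_of_map_mkQ_fg {R M ι : Type*} [Ring R] [AddCommGroup M] [Module R M]
    [SemilatticeSup ι] [Nonempty ι] {A B : Submodule R M} (hfg : (A.map B.mkQ).FG)
    {C : ι → Submodule R M} (hC : Monotone C) (hB : ∃ i, B ≤ C i) (hA : ∀ x ∈ A, ∃ i, x ∈ C i) :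
    ∃ i, A ≤ C i := by
  have hmono : Monotone fun i => (C i).map B.mkQ := fun i j h => Submodule.map_mono (hC h)
  have hle : A.map B.mkQ ≤ ⨆ i, (C i).map B.mkQ := by
    rintro _ ⟨x, hx, rfl⟩
    obtain ⟨i, hi⟩ := hA x hx
    exact Submodule.mem_iSup_of_mem i ⟨x, hi, rfl⟩
  obtain ⟨_, ⟨i, rfl⟩, hi⟩ := (Submodule.fg_iff_compact _).1 hfg _ _ (Set.range_nonempty _)
    hmono.directed_le.directedOn_range isLUB_iSup hle
  obtain ⟨j, hj⟩ := hB
  refine ⟨i ⊔ j, fun x hx => ?_⟩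
  obtain ⟨y, hy, hyx⟩ := hi ⟨x, hx, rfl⟩
  have hxy : x - y ∈ B := (Submodule.Quotient.eq B).1 hyx.symm
  simpa using add_mem (hC le_sup_right (hj hxy)) (hC le_sup_left hy)

variable {k : Type u} [Field k] [TopologicalSpace k]

namespace TateRealization

variable {X Y : TateIdx ⥤ FGModuleCat.{u} k} {V W : TopModuleCat.{u} k}

theorem map_mkQ_fg (R : TateRealization X V) (q : TateIdx) :
    ((R.L q.1.2).map (R.L q.1.1).mkQ).FG := by
  have hker : (R.proj q).ker = (R.L q.1.1).submoduleOf (R.L q.1.2) :=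
    Submodule.ext (R.proj_eq_zero_iff q)
  rw [← finite_quotient_submoduleOf_iff, ← hker]
  exact Module.Finite.equiv ((R.proj q).quotKerEquivOfSurjective (R.proj_surjective q)).symm

theorem exists_bicofinal (R : TateRealization X V) (S : TateRealization Y W) (T : V ⟶ W) :
    ∃ φ : Bicofinal, (∀ n, φ.toFun n ≤ n) ∧ ∀ n, ∀ x ∈ R.L (φ.toFun n), T.hom x ∈ S.L n := by
  have hleft n : ∃ m, ∀ x ∈ R.L m, T.hom x ∈ S.L n :=
    R.isTateFiltration.exists_le _ <| T.hom.continuous.continuousAt.preimage_mem_nhds <| by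
      rw [map_zero]
      exact (S.isTateFiltration.isOpen n).mem_nhds (zero_mem _)
  refine Bicofinal.exists_of_rel (fun m n => ∀ x ∈ R.L m, T.hom x ∈ S.L n)
    (fun hm hn h x hx => S.mono hn (h x (R.mono hm hx))) hleft fun m => ?_
  obtain ⟨i, hi⟩ := hleft 0
  exact exists_le_of_map_mkQ_fg (R.map_mkQ_fg (TateIdx.mk (min i m) m (min_le_right i m)))
    (C := fun n => (S.L n).comap T.hom.toLinearMap) (fun a b h => Submodule.comap_mono (S.mono h))
    ⟨0, fun x hx => hi x (R.mono (min_le_left i m) hx)⟩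
    fun x _ => S.isTateFiltration.exists_mem (T.hom x)

section

variable {X : AdmBiFun (FGModuleCat.{u} k)} (R : TateRealization X.obj V) {φ₀ φ₁ φ : Bicofinal}

theorem compat_reindexHom (h : ∀ n, φ₀.toFun n ≤ φ₁.toFun n) :
    (R.reindex φ₀).Compat (R.reindex φ₁) (X.reindexHom h).hom (𝟙 V) := fun x q hx =>
  ⟨R.mono (h _) hx, (R.map_proj (TateIdx.hom (φ₀.monotone' q.2) (φ₁.monotone' q.2)
    (h q.1.1) (h q.1.2)) ⟨x, hx⟩).symm⟩

theorem compat_fromReindex (h : ∀ n, φ.toFun n ≤ n) :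
    (R.reindex φ).Compat R (X.fromReindex φ h).hom (𝟙 V) :=
  R.compat_reindexHom (φ₁ := Bicofinal.id) h

end

variable [DiscreteTopology k] (R : TateRealization X V) (S : TateRealization Y W)
  (hX : IsAdmissibleBiFun _ X) (hY : IsAdmissibleBiFun _ Y)

/-- The identification of `colim_j lim_i X_{ij}` with the space underlying a realization of `X`. -/
noncomputable def iso : (indProLim k).obj X ≅ V :=
  ((indProLim.realization hX).exists_iso R).choose

theorem compat_iso_hom : (indProLim.realization hX).Compat R (𝟙 X) (R.iso hX).hom :=
  ((indProLim.realization hX).exists_iso R).choose_spec.1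

variable {R S} in
theorem Compat.map_comp_iso_hom {f : X ⟶ Y} {T : V ⟶ W} (h : R.Compat S f T) :
    (indProLim k).map f ≫ (S.iso hY).hom = (R.iso hX).hom ≫ T := by
  have hmap := (indProLim.compat_map hX hY f).comp (S.compat_iso_hom hY)
  have hiso := (R.compat_iso_hom hX).comp h
  rw [Category.comp_id] at hmap
  rw [Category.id_comp] at hiso
  exact hmap.unique hiso

end TateRealization

variable [DiscreteTopology k]

/-- The functor `(V_{ij}) ↦ colim_j lim_i V_{ij}` on admissible functors. -/
noncomputable def admLim : AdmBiFun (FGModuleCat.{u} k) ⥤ CountableLLCCat k :=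
  ObjectProperty.lift _ ((IsAdmissibleBiFun (FGModuleCat.{u} k)).ι ⋙ indProLim k)
    fun X => (indProLim.realization X.property).countableLLC

namespace indProLim

variable {X Y : AdmBiFun (FGModuleCat.{u} k)}

theorem isIso_map_reindexHom {φ₀ φ₁ : Bicofinal} (h : ∀ n, φ₀.toFun n ≤ φ₁.toFun n) :
    IsIso ((indProLim k).map (X.reindexHom h).hom) := by
  have hmap := ((realization X.property).compat_reindexHom h).map_comp_iso_hom
    (X.reindex φ₀).property (X.reindex φ₁).property
  rw [Category.comp_id, ← Iso.eq_comp_inv] at hmap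
  rw [hmap]
  infer_instance

theorem map_hom_injective {f g : X ⟶ Y} (h : (indProLim k).map f.hom = (indProLim k).map g.hom) :
    f = g :=
  ObjectProperty.hom_ext _ <| (compat_map X.property Y.property f.hom).injective <|
    h ▸ compat_map X.property Y.property g.hom

theorem exists_map_fromReindex_comp_eq (T : (indProLim k).obj X.obj ⟶ (indProLim k).obj Y.obj) :
    ∃ (φ : Bicofinal) (h : ∀ n, φ.toFun n ≤ n) (f : X.reindex φ ⟶ Y),
      (indProLim k).map (X.fromReindex φ h).hom ≫ T = (indProLim k).map f.hom := by
  let R := realization X.property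
  let S := realization Y.property
  let T' := (R.iso X.property).inv ≫ T ≫ (S.iso Y.property).hom
  obtain ⟨φ, hφ, hT'⟩ := R.exists_bicofinal S T'
  obtain ⟨f, hf⟩ := (R.reindex φ).exists_hom_compat S T' hT'
  have hmap_f := hf.map_comp_iso_hom (X.reindex φ).property Y.property
  have hmap_from := (R.compat_fromReindex hφ).map_comp_iso_hom (X.reindex φ).property X.property
  refine ⟨φ, hφ, ObjectProperty.homMk f, ?_⟩
  rw [Category.comp_id] at hmap_from
  rw [← cancel_mono (S.iso Y.property).hom]
  refine Eq.trans ?_ hmap_f.symm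
  simp only [T', ← hmap_from, Category.assoc, Iso.hom_inv_id_assoc]

end indProLim

theorem beilinsonU_isInvertedBy_admLim :
    (beilinsonU (FGModuleCat.{u} k)).IsInvertedBy (admLim (k := k)) := by
  rintro _ _ _ ⟨X, φ₀, φ₁, h⟩
  have : IsIso ((countableLLCProp k).ι.map (admLim.map (X.reindexHom h))) :=
    indProLim.isIso_map_reindexHom h
  exact (countableLLCProp k).fullyFaithfulι.isIso_of_isIso_map _

/-- The functor from Tate spaces to locally linearly compact spaces of countable type induced by
`(V_{ij}) ↦ colim_j lim_i V_{ij}`. -/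
noncomputable def tateLim : TateCat k ⥤ CountableLLCCat k :=
  Localization.Construction.lift admLim beilinsonU_isInvertedBy_admLim

/-- The comparison of `tateLim` with `admLim` along the localization functor. -/
noncomputable def tateLimIso : (beilinsonU (FGModuleCat.{u} k)).Q ⋙ tateLim ≅ admLim :=
  eqToIso (Localization.Construction.fac _ _)

namespace tateLim

variable {X Y : AdmBiFun (FGModuleCat.{u} k)}

theorem map_Q (f : X ⟶ Y) :
    (tateLim.map ((beilinsonU (FGModuleCat.{u} k)).Q.map f)).hom = (indProLim k).map f.hom :=
  rfl

theorem map_injective {a b : (beilinsonU _).Q.obj X ⟶ (beilinsonU _).Q.obj Y}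
    (h : (tateLim (k := k)).map a = tateLim.map b) : a = b := by
  obtain ⟨φ, hφ, f, g, hf, hg⟩ := AdmBiFun.exists_common_roof a b
  have hfg : f = g := indProLim.map_hom_injective <| by
    rw [← map_Q, ← map_Q, ← hf, ← hg, Functor.map_comp, Functor.map_comp, h]
  rw [← cancel_epi ((beilinsonU _).Q.map (X.fromReindex φ hφ)), hf, hg, hfg]

theorem map_surjective
    (T : (tateLim (k := k)).obj ((beilinsonU _).Q.obj X) ⟶ tateLim.obj ((beilinsonU _).Q.obj Y)) :
    ∃ a, tateLim.map a = T := by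
  obtain ⟨φ, hφ, f, hf⟩ := indProLim.exists_map_fromReindex_comp_eq (X := X) (Y := Y) T.hom
  refine ⟨inv ((beilinsonU _).Q.map (X.fromReindex φ hφ)) ≫ (beilinsonU _).Q.map f, ?_⟩
  rw [Functor.map_comp, Functor.map_inv, IsIso.inv_comp_eq]
  exact ObjectProperty.hom_ext _ ((map_Q f).trans hf.symm)

instance : (tateLim (k := k)).Faithful where
  map_injective {A B} _ _ h :=
    map_injective (X := (Localization.Construction.objEquiv _).symm A)
      (Y := (Localization.Construction.objEquiv _).symm B) h

instance : (tateLim (k := k)).Full where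
  map_surjective {A B} T :=
    map_surjective (X := (Localization.Construction.objEquiv _).symm A)
      (Y := (Localization.Construction.objEquiv _).symm B) T

instance : (tateLim (k := k)).EssSurj where
  mem_essImage V := by
    obtain ⟨X, hX, ⟨R⟩⟩ := exists_tateRealization V.obj V.property
    exact ⟨(beilinsonU _).Q.obj ⟨X, hX⟩,
      ⟨tateLimIso.app _ ≪≫ (countableLLCProp k).isoMk (R.iso hX)⟩⟩

instance : (tateLim (k := k)).IsEquivalence where

end tateLim

end TateFunctorEquivalence

section IndObjects

variable {D : Type u} [Category.{v} D]

/-- Morphisms from a representable ind-object to an ind-object `Z` are the elements of the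
presheaf underlying `Z`. -/
noncomputable def indCoyonedaYonedaIso (X : D) :
    coyoneda.obj (op (Ind.yoneda.obj X)) ≅
      Ind.inclusion D ⋙ (evaluation Dᵒᵖ (Type v)).obj (op X) :=
  NatIso.ofComponents
    (fun Z => (Ind.inclusion.fullyFaithful.homEquiv.trans
      (((Ind.yonedaCompInclusion.app X).homFromEquiv).trans yonedaEquiv)).toIso)
    (fun {Z Z'} f => by
      ext g
      simp [yonedaEquiv, Functor.FullyFaithful.homEquiv])

theorem preservesColimitsOfShape_coyoneda_indYoneda (X : D) (J : Type v) [SmallCategory J]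
    [IsFiltered J] : PreservesColimitsOfShape J (coyoneda.obj (op (Ind.yoneda.obj X))) :=
  have : PreservesColimitsOfShape J (Ind.inclusion D) := inferInstance
  preservesColimitsOfShape_of_natIso (indCoyonedaYonedaIso X).symm

variable {J : Type v} [SmallCategory J] [IsFiltered J] {G : J ⥤ D} {c : Cocone (G ⋙ Ind.yoneda)}

theorem indYoneda_exists_fac_of_isColimit (hc : IsColimit c) {X : D}
    (f : Ind.yoneda.obj X ⟶ c.pt) :
    ∃ (j : J) (a : X ⟶ G.obj j), Ind.yoneda.map a ≫ c.ι.app j = f := by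
  have := preservesColimitsOfShape_coyoneda_indYoneda X J
  obtain ⟨j, g, hg⟩ := Types.jointly_surjective _
    (isColimitOfPreserves (coyoneda.obj (op (Ind.yoneda.obj X))) hc) f
  obtain ⟨a, rfl⟩ := Ind.yoneda.map_surjective g
  exact ⟨j, a, hg⟩

theorem indYoneda_exists_comp_map_eq_of_isColimit (hc : IsColimit c) {X : D} {j : J}
    {a b : X ⟶ G.obj j}
    (h : Ind.yoneda.map a ≫ c.ι.app j = Ind.yoneda.map b ≫ c.ι.app j) :
    ∃ (i : J) (t : j ⟶ i), a ≫ G.map t = b ≫ G.map t := by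
  have := preservesColimitsOfShape_coyoneda_indYoneda X J
  obtain ⟨i, t, ht⟩ := (Types.FilteredColimit.isColimit_eq_iff'
    (isColimitOfPreserves (coyoneda.obj (op (Ind.yoneda.obj X))) hc) (Ind.yoneda.map a)
    (Ind.yoneda.map b)).1 h
  refine ⟨i, t, Ind.yoneda.map_injective ?_⟩
  rw [Functor.map_comp, Functor.map_comp]
  exact ht

end IndObjects

section ProObjects

variable {C : Type u} [Category.{v} C]

namespace ProObj

instance : (const C).Full :=
  inferInstanceAs (opOp C ⋙ (Ind.yoneda (C := Cᵒᵖ)).op).Full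

instance : (const C).Faithful :=
  inferInstanceAs (opOp C ⋙ (Ind.yoneda (C := Cᵒᵖ)).op).Faithful

theorem exists_iso_lim (X : ProObj C) :
    ∃ (J : Type v) (_ : SmallCategory J) (_ : IsFiltered J) (F : Jᵒᵖ ⥤ C),
      Nonempty (X ≅ (lim C J).obj F) := by
  let P := X.unop.presentation
  exact ⟨P.I, inferInstance, inferInstance, P.F.leftOp,
    ⟨(Ind.colimitPresentationCompYoneda X.unop).op⟩⟩

variable {J : Type v} [SmallCategory J] [IsFiltered J]

theorem lim_map_cone_π {F G : Jᵒᵖ ⥤ C} (f : F ⟶ G) (j : Jᵒᵖ) :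
    (lim C J).map f ≫ (cone G).π.app j = (cone F).π.app j ≫ (const C).map (f.app j) :=
  Quiver.Hom.unop_inj (ι_colimMap (Functor.whiskerRight (NatTrans.rightOp f) Ind.yoneda) j.unop)

variable (F : Jᵒᵖ ⥤ C)

/-- The canonical cone exhibits a formal limit as a limit of constant pro-objects. -/
noncomputable def isLimitCone : IsLimit (cone F) :=
  (colimit.isColimit (F.rightOp ⋙ Ind.yoneda)).op

theorem exists_fac {c : C} (f : (lim C J).obj F ⟶ (const C).obj c) :
    ∃ (j : Jᵒᵖ) (a : F.obj j ⟶ c), (cone F).π.app j ≫ (const C).map a = f := by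
  obtain ⟨j, a, h⟩ := indYoneda_exists_fac_of_isColimit
    (colimit.isColimit (F.rightOp ⋙ Ind.yoneda)) (X := op c) f.unop
  exact ⟨op j, a.unop, Quiver.Hom.unop_inj h⟩

theorem exists_fac₂ {c d : C} (f : (lim C J).obj F ⟶ (const C).obj c)
    (g : (lim C J).obj F ⟶ (const C).obj d) :
    ∃ (j : Jᵒᵖ) (a : F.obj j ⟶ c) (b : F.obj j ⟶ d),
      (cone F).π.app j ≫ (const C).map a = f ∧ (cone F).π.app j ≫ (const C).map b = g := by
  obtain ⟨i, a, rfl⟩ := exists_fac F f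
  obtain ⟨j, b, rfl⟩ := exists_fac F g
  have hi := (cone F).w (IsCofiltered.minToLeft i j)
  have hj := (cone F).w (IsCofiltered.minToRight i j)
  refine ⟨IsCofiltered.min i j, F.map (IsCofiltered.minToLeft i j) ≫ a,
    F.map (IsCofiltered.minToRight i j) ≫ b, ?_, ?_⟩
  · rw [← hi, Functor.comp_map, Functor.map_comp, Category.assoc]
  · rw [← hj, Functor.comp_map, Functor.map_comp, Category.assoc]

theorem exists_map_comp_eq {c : C} {j : Jᵒᵖ} {a b : F.obj j ⟶ c}
    (h : (cone F).π.app j ≫ (const C).map a = (cone F).π.app j ≫ (const C).map b) :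
    ∃ (i : Jᵒᵖ) (t : i ⟶ j), F.map t ≫ a = F.map t ≫ b := by
  obtain ⟨i, t, ht⟩ := indYoneda_exists_comp_map_eq_of_isColimit
    (colimit.isColimit (F.rightOp ⋙ Ind.yoneda)) (X := op c) (a := a.op) (b := b.op)
    (congrArg Quiver.Hom.unop h)
  exact ⟨op i, t.op, congrArg Quiver.Hom.unop ht⟩

/-- The functor `j ↦ ("lim" F ⟶ F_j)`. It is initial, so a pointwise right Kan extension along
`ProObj.const` is computed at `"lim" F` by the limit over the index category of `F`. -/
noncomputable def toStructuredArrow : Jᵒᵖ ⥤ StructuredArrow ((lim C J).obj F) (const C) :=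
  F.toStructuredArrow _ _ (fun j => (cone F).π.app j) fun f => (cone F).w f

instance : (toStructuredArrow F).Initial :=
  Functor.initial_of_exists_of_isCofiltered _
    (fun d => by
      obtain ⟨j, a, h⟩ := exists_fac F d.hom
      exact ⟨j, ⟨StructuredArrow.homMk a h⟩⟩)
    (fun {d c} s s' => by
      obtain ⟨i, t, h⟩ := exists_map_comp_eq F (a := s.right) (b := s'.right)
        ((StructuredArrow.w s).trans (StructuredArrow.w s').symm)
      exact ⟨i, t, StructuredArrow.hom_ext _ _ h⟩)

variable {H : Type w} [Category.{w'} H] (L : C ⥤ H)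

theorem hasPointwiseRightKanExtension_const [HasLimitsOfSize.{v, v} H] :
    (const C).HasPointwiseRightKanExtension L := fun X => by
  obtain ⟨J, _, _, F, ⟨e⟩⟩ := X.exists_iso_lim
  rw [Functor.hasPointwiseRightKanExtensionAt_iff_of_iso _ _ e]
  have : HasLimit (toStructuredArrow F ⋙ StructuredArrow.proj _ _ ⋙ L) :=
    inferInstanceAs (HasLimit (F ⋙ L))
  exact Functor.Initial.hasLimit_of_comp (toStructuredArrow F)

/-- A pointwise right Kan extension along `ProObj.const` sends formal limits to limits. -/
noncomputable def isLimitOfIsPointwiseRightKanExtension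
    {E : (const C).RightExtension L} (hE : E.IsPointwiseRightKanExtension) :
    IsLimit ((Cone.postcompose (Functor.whiskerLeft F E.hom)).obj (E.left.mapCone (cone F))) :=
  (Functor.Initial.isLimitWhiskerEquiv (toStructuredArrow F) _).symm (hE _)

end ProObj

end ProObjects

section ProjectiveLimitFunctor

variable {k : Type u} [Field k] [TopologicalSpace k] [DiscreteTopology k]

open discreteFunctor

theorem exists_isProjectiveLimitFunctor : ∃ Λ, IsProjectiveLimitFunctor k Λ := by
  have : HasLimitsOfSize.{u, u} (TopModuleCat.{u} k) := inferInstance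
  have := ProObj.hasPointwiseRightKanExtension_const (discreteFunctor k)
  let E := Functor.RightExtension.mk _
    (Functor.pointwiseRightKanExtensionCounit (ProObj.const _) (discreteFunctor k))
  have hE : E.IsPointwiseRightKanExtension :=
    Functor.pointwiseRightKanExtensionIsPointwiseRightKanExtension _ _
  have : IsIso E.hom := hE.isIso_hom
  exact ⟨E.left, asIso E.hom, fun J _ _ F =>
    ⟨ProObj.isLimitOfIsPointwiseRightKanExtension F (discreteFunctor k) hE⟩⟩

namespace IsProjectiveLimitFunctor

variable {Λ : ProObj (FGModuleCat.{u} k) ⥤ TopModuleCat.{u} k} (hΛ : IsProjectiveLimitFunctor k Λ)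

/-- The identification of the values at constant pro-objects with discrete spaces. -/
noncomputable def constIso : ProObj.const (FGModuleCat.{u} k) ⋙ Λ ≅ discreteFunctor k := hΛ.choose

/-- The projections `Λ("lim" F_j) ⟶ F_j`. -/
noncomputable def cone {J : Type u} [SmallCategory J] [IsFiltered J]
    (F : Jᵒᵖ ⥤ FGModuleCat.{u} k) : Cone (F ⋙ discreteFunctor k) :=
  (Cone.postcompose (Functor.whiskerLeft F hΛ.constIso.hom)).obj (Λ.mapCone (ProObj.cone F))

/-- The projections `Λ("lim" F_j) ⟶ F_j` form a limit cone. -/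
noncomputable def isLimit {J : Type u} [SmallCategory J] [IsFiltered J]
    (F : Jᵒᵖ ⥤ FGModuleCat.{u} k) : IsLimit (hΛ.cone F) :=
  (hΛ.choose_spec J F).some

include hΛ in
theorem isLinearlyCompact (X : ProObj (FGModuleCat.{u} k)) : IsLinearlyCompact k (Λ.obj X) := by
  obtain ⟨J, _, _, F, ⟨e⟩⟩ := X.exists_iso_lim
  have hF : IsLinearlyCompact k (Λ.obj ((ProObj.lim (FGModuleCat.{u} k) J).obj F)) :=
    limit_isLinearlyCompact (hΛ.isLimit F)
  exact hF.of_continuousLinearEquiv (Λ.mapIso e.symm).toContinuousLinearEquiv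

section

variable {X Y : ProObj (FGModuleCat.{u} k)} {c d : FGModuleCat.{u} k}

/-- The linear map `Λ X → c` induced by a morphism from `X` to the constant pro-object `c`. -/
noncomputable def linearMap (f : X ⟶ (ProObj.const _).obj c) : Λ.obj X →ₗ[k] c :=
  toLin (Λ.map f ≫ hΛ.constIso.hom.app c)

theorem linearMap_comp (g : Y ⟶ X) (f : X ⟶ (ProObj.const _).obj c) (y : Λ.obj Y) :
    hΛ.linearMap (g ≫ f) y = hΛ.linearMap f ((Λ.map g).hom y) := by
  rw [linearMap, Λ.map_comp, Category.assoc]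
  rfl

theorem linearMap_comp_const (f : X ⟶ (ProObj.const _).obj c) (a : c ⟶ d) (x : Λ.obj X) :
    hΛ.linearMap (f ≫ (ProObj.const _).map a) x = a.hom.hom (hΛ.linearMap f x) := by
  have hnat : Λ.map (f ≫ (ProObj.const _).map a) ≫ hΛ.constIso.hom.app d =
      (Λ.map f ≫ hΛ.constIso.hom.app c) ≫ (discreteFunctor k).map a := by
    rw [Λ.map_comp, Category.assoc, Category.assoc, ← hΛ.constIso.hom.naturality a]
    rfl
  exact congrArg (fun g => toLin g x) hnat

end

section

variable {J : Type u} [SmallCategory J] [IsFiltered J] {F : Jᵒᵖ ⥤ FGModuleCat.{u} k}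
  (hF : ∀ (a b : Jᵒᵖ) (f : a ⟶ b), Epi (F.map f))
include hF

theorem linearMap_cone_π_surjective (j : Jᵒᵖ) :
    Function.Surjective (hΛ.linearMap ((ProObj.cone F).π.app j)) :=
  limit_surjective (hΛ.isLimit F)
    (fun a b f => (fgModuleCat_epi_iff_surjective (F.map f)).1 (hF a b f)) j

theorem linearMap_injective {c : FGModuleCat.{u} k}
    {f g : (ProObj.lim _ J).obj F ⟶ (ProObj.const _).obj c}
    (h : hΛ.linearMap f = hΛ.linearMap g) : f = g := by
  obtain ⟨j, a, b, rfl, rfl⟩ := ProObj.exists_fac₂ F f g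
  have hab : a = b := FGModuleCat.hom_ext <| LinearMap.ext <|
    (hΛ.linearMap_cone_π_surjective hF j).forall.2 fun x =>
      (hΛ.linearMap_comp_const _ a x).symm.trans
        ((LinearMap.congr_fun h x).trans (hΛ.linearMap_comp_const _ b x))
  rw [hab]

-- The kernel of a continuous map to a discrete space contains the kernel of a projection.
theorem exists_linearMap_eq {c : FGModuleCat.{u} k}
    (g : Λ.obj ((ProObj.lim _ J).obj F) ⟶ (discreteFunctor k).obj c) :
    ∃ f : (ProObj.lim _ J).obj F ⟶ (ProObj.const _).obj c, hΛ.linearMap f = toLin g := by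
  obtain ⟨j, -, hj⟩ := (limit_hasBasis (hΛ.isLimit F)).mem_iff.1
    ((isOpen_ker_toLin g).mem_nhds (zero_mem _))
  let p : Λ.obj ((ProObj.lim _ J).obj F) →ₗ[k] F.obj j := hΛ.linearMap ((ProObj.cone F).π.app j)
  obtain ⟨s, hs⟩ := LinearMap.exists_rightInverse_of_surjective p
    (LinearMap.range_eq_top.2 (hΛ.linearMap_cone_π_surjective hF j))
  refine ⟨(ProObj.cone F).π.app j ≫ (ProObj.const _).map (FGModuleCat.ofHom (toLin g ∘ₗ s)),
    LinearMap.ext fun x => (hΛ.linearMap_comp_const _ _ _).trans ?_⟩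
  have hker : p (s (p x) - x) = 0 :=
    (map_sub p _ x).trans (sub_eq_zero.2 (LinearMap.congr_fun hs _))
  exact sub_eq_zero.1 ((map_sub (toLin g) _ x).symm.trans (hj hker))

variable {Y : ProObj (FGModuleCat.{u} k)}

include hΛ in
theorem map_injective_of_epi {f g : (ProObj.lim _ J).obj F ⟶ Y} (h : Λ.map f = Λ.map g) :
    f = g := by
  obtain ⟨I, _, _, G, ⟨(e : Y ≅ (ProObj.cone G).pt)⟩⟩ := Y.exists_iso_lim
  rw [← cancel_mono e.hom]
  refine (ProObj.isLimitCone G).hom_ext fun i =>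
    hΛ.linearMap_injective hF (LinearMap.ext fun x => ?_)
  rw [linearMap_comp, linearMap_comp, Λ.map_comp, Λ.map_comp, h]

include hΛ in
theorem map_surjective_of_epi (g : Λ.obj ((ProObj.lim _ J).obj F) ⟶ Λ.obj Y) :
    ∃ f, Λ.map f = g := by
  obtain ⟨I, _, _, G, ⟨(e : Y ≅ (ProObj.cone G).pt)⟩⟩ := Y.exists_iso_lim
  choose f hf using fun i => hΛ.exists_linearMap_eq hF (g ≫ Λ.map e.hom ≫ (hΛ.cone G).π.app i)
  have hcompat {a b : Iᵒᵖ} (t : a ⟶ b) : f b = f a ≫ (ProObj.const _).map (G.map t) :=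
    hΛ.linearMap_injective hF <| LinearMap.ext fun x => by
      refine Eq.trans ?_ (hΛ.linearMap_comp_const _ _ _).symm
      rw [hf, hf]
      exact (map_coneProj (hΛ.cone G) t _).symm
  let s : Cone (G ⋙ ProObj.const _) :=
    { pt := (ProObj.lim _ J).obj F
      π := { app := f, naturality := fun _ _ t => (Category.id_comp _).trans (hcompat t) } }
  refine ⟨(ProObj.isLimitCone G).lift s ≫ e.inv, ?_⟩
  rw [Λ.map_comp, ← Functor.mapIso_inv, Iso.comp_inv_eq]
  refine (hΛ.isLimit G).hom_ext fun i => toLin_injective (LinearMap.ext fun x => ?_)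
  refine (hΛ.linearMap_comp ((ProObj.isLimitCone G).lift s) ((ProObj.cone G).π.app i) x).symm.trans
    (Eq.trans ?_ (LinearMap.congr_fun (hf i) x))
  rw [(ProObj.isLimitCone G).fac s i]

end

/-- The functor from strict pro-objects to linearly compact spaces induced by `Λ`. -/
noncomputable def strictFunctor : StrictProVect k ⥤ LinearlyCompactCat k :=
  ObjectProperty.lift _ ((IsStrictPro _).ι ⋙ Λ) fun X => hΛ.isLinearlyCompact X.obj

instance : hΛ.strictFunctor.Faithful where
  map_injective {X Y} f g h := by
    obtain ⟨J, _, _, F, hF, ⟨e⟩⟩ := X.property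
    refine ObjectProperty.hom_ext _ ((cancel_epi e.inv).1 (hΛ.map_injective_of_epi hF ?_))
    rw [Λ.map_comp, Λ.map_comp]
    exact congrArg (fun t => Λ.map e.inv ≫ t.hom) h

instance : hΛ.strictFunctor.Full where
  map_surjective {X Y} g := by
    obtain ⟨J, _, _, F, hF, ⟨e⟩⟩ := X.property
    let g' : Λ.obj X.obj ⟶ Λ.obj Y.obj := g.hom
    obtain ⟨f, hf⟩ := hΛ.map_surjective_of_epi hF (Λ.map e.inv ≫ g')
    refine ⟨ObjectProperty.homMk (e.hom ≫ f), ObjectProperty.hom_ext _ ?_⟩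
    change Λ.map (e.hom ≫ f) = g'
    rw [Λ.map_comp, hf, ← Category.assoc, ← Λ.map_comp, e.hom_inv_id, Λ.map_id, Category.id_comp]

end IsProjectiveLimitFunctor

end ProjectiveLimitFunctor

section QuotientSystem

variable {k : Type u} [Field k]

/-- The projective system of the quotients `V ⧸ U j` by a decreasing family of subspaces. -/
def quotientSystem {V : Type v} [AddCommGroup V] [Module k V] {J : Type w} [Preorder J]
    {U : J → Submodule k V} (hU : Antitone U) (hfin : ∀ j, Module.Finite k (V ⧸ U j)) :
    Jᵒᵖ ⥤ FGModuleCat.{v} k where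
  obj j := ⟨ModuleCat.of k (V ⧸ U j.unop), hfin _⟩
  map f := ObjectProperty.homMk (ModuleCat.ofHom (Submodule.factor (hU (leOfHom f.unop))))
  map_id _ :=
    FGModuleCat.hom_ext (LinearMap.ext ((Submodule.mkQ_surjective _).forall.2 fun _ => rfl))
  map_comp _ _ :=
    FGModuleCat.hom_ext (LinearMap.ext ((Submodule.mkQ_surjective _).forall.2 fun _ => rfl))

variable [TopologicalSpace k] [DiscreteTopology k]

open discreteFunctor

variable {V : TopModuleCat.{u} k} {J : Type w} [Preorder J] {U : J → Submodule k V}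
  (hU : Antitone U) (hfin : ∀ j, Module.Finite k (V ⧸ U j))

/-- The cone of the projections `V ⟶ V ⧸ U j`, for open subspaces `U j`. -/
def quotientCone (hopen : ∀ j, IsOpen (U j : Set V)) :
    Cone (quotientSystem hU hfin ⋙ discreteFunctor k) where
  pt := V
  π :=
    { app := fun j => ofLin (X := V) (E := (quotientSystem hU hfin).obj j) (U j.unop).mkQ
        ((congrArg (fun W : Submodule k V => IsOpen (W : Set V)) (Submodule.ker_mkQ _)).mpr
          (hopen _))
      naturality := fun _ _ _ => rfl }

theorem nonempty_isLimit_quotientCone [IsDirectedOrder J] [Nonempty J]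
    (hV : IsLinearlyCompact k V) (hopen : ∀ j, IsOpen (U j : Set V))
    (hbasis : (𝓝 (0 : V)).HasBasis (fun _ => True) fun j => (U j : Set V)) :
    Nonempty (IsLimit (quotientCone hU hfin hopen)) := by
  have hker (j : Jᵒᵖ) : (coneProj (quotientCone hU hfin hopen) j).ker = U j.unop :=
    Submodule.ker_mkQ _
  refine nonempty_isLimit_of_isLinearlyCompact _ hV (fun j => (U j.unop).mkQ_surjective)
    (hbasis.to_hasBasis ?_ ?_)
  · exact fun j _ => ⟨op j, trivial, (hker (op j)).le⟩
  · exact fun j _ => ⟨j.unop, trivial, (hker j).ge⟩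

end QuotientSystem

section StrictFunctorEquivalence

variable {k : Type u} [Field k] [TopologicalSpace k] [DiscreteTopology k]
  {Λ : ProObj (FGModuleCat.{u} k) ⥤ TopModuleCat.{u} k} (hΛ : IsProjectiveLimitFunctor k Λ)

namespace IsProjectiveLimitFunctor

include hΛ in
theorem exists_epi_lim_iso {V : TopModuleCat.{u} k} {J : Type u} [Preorder J] [IsDirectedOrder J]
    [Nonempty J] {U : J → Submodule k V} (hV : IsLinearlyCompact k V) (hU : Antitone U)
    (hopen : ∀ j, IsOpen (U j : Set V))
    (hbasis : (𝓝 (0 : V)).HasBasis (fun _ => True) fun j => (U j : Set V)) :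
    ∃ F : Jᵒᵖ ⥤ FGModuleCat.{u} k, (∀ (a b : Jᵒᵖ) (f : a ⟶ b), Epi (F.map f)) ∧
      Nonempty (Λ.obj ((ProObj.lim _ J).obj F) ≅ V) := by
  have hfin j := hV.finite_quotient (hopen j)
  obtain ⟨hlim⟩ := nonempty_isLimit_quotientCone hU hfin hV hopen hbasis
  refine ⟨quotientSystem hU hfin, fun a b f => ?_,
    ⟨(hΛ.isLimit _).conePointUniqueUpToIso hlim⟩⟩
  exact (fgModuleCat_epi_iff_surjective _).2
    ((Submodule.mkQ_surjective _).forall.2 fun x => ⟨(U a.unop).mkQ x, rfl⟩)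

instance : hΛ.strictFunctor.EssSurj where
  mem_essImage V := by
    have hV : IsLinearlyCompact k V.obj := V.property
    have := hV.linear
    let J := {U : Submodule k V.obj // IsOpen (U : Set V.obj)}ᵒᵈ
    have : Nonempty J := ⟨OrderDual.toDual ⟨⊤, isOpen_univ⟩⟩
    have : IsDirectedOrder J := ⟨fun a b => ⟨OrderDual.toDual
      ⟨(OrderDual.ofDual a).1 ⊓ (OrderDual.ofDual b).1,
        (OrderDual.ofDual a).2.inter (OrderDual.ofDual b).2⟩, fun _ h => h.1, fun _ h => h.2⟩⟩
    have hbasis : (𝓝 (0 : V.obj)).HasBasis (fun _ => True)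
        fun U : J => ((OrderDual.ofDual U).1 : Set V.obj) :=
      (IsLinearTopology.hasBasis_open_submodule k).to_hasBasis
        (fun U hU => ⟨OrderDual.toDual ⟨U, hU⟩, trivial, subset_rfl⟩)
        (fun U _ => ⟨(OrderDual.ofDual U).1, (OrderDual.ofDual U).2, subset_rfl⟩)
    obtain ⟨F, hF, ⟨e⟩⟩ := hΛ.exists_epi_lim_iso hV (fun _ _ h => h)
      (fun U : J => (OrderDual.ofDual U).2) hbasis
    exact ⟨⟨(ProObj.lim _ J).obj F, J, inferInstance, inferInstance, F, hF, ⟨Iso.refl _⟩⟩,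
      ⟨(linearlyCompactProp k).isoMk e⟩⟩

instance : hΛ.strictFunctor.IsEquivalence where

end IsProjectiveLimitFunctor

end StrictFunctorEquivalence

section CountableProObjects

variable {k : Type u} [Field k] [TopologicalSpace k]

theorem IsLinearlyCompact.countableLLC {V : TopModuleCat.{u} k} (hV : IsLinearlyCompact k V)
    (hc : (𝓝 (0 : V)).IsCountablyGenerated) : countableLLCProp k V := by
  have htop : IsOpen ((⊤ : Submodule k V) : Set V) ∧ IsLinearlyCompact k (⊤ : Submodule k V) :=
    ⟨isOpen_univ, hV.of_continuousLinearEquiv Submodule.topContEquiv.symm⟩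
  exact ⟨⟨hV.t2, hV.linear, ⊤, htop⟩, hc, fun _ => ⊤, fun _ => htop, fun _ => ⟨0, trivial⟩⟩

variable [DiscreteTopology k]

open discreteFunctor

namespace IsProjectiveLimitFunctor

variable {Λ : ProObj (FGModuleCat.{u} k) ⥤ TopModuleCat.{u} k} (hΛ : IsProjectiveLimitFunctor k Λ)

include hΛ in
theorem isCountablyGenerated_nhds_zero {X : ProObj (FGModuleCat.{u} k)}
    (hX : IsCountableStrictPro _ X) : (𝓝 (0 : Λ.obj X)).IsCountablyGenerated := by
  obtain ⟨J, _, _, _, F, -, ⟨e⟩⟩ := hX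
  have : Countable Jᵒᵖ := Countable.of_equiv _ equivToOpposite
  have hlim : (𝓝 (0 : Λ.obj ((ProObj.lim _ J).obj F))).IsCountablyGenerated :=
    limit_isCountablyGenerated (hΛ.isLimit F)
  let e' := (Λ.mapIso e).toContinuousLinearEquiv
  rw [e'.toHomeomorph.isInducing.nhds_eq_comap, show e'.toHomeomorph 0 = 0 from map_zero e']
  exact Filter.comap.isCountablyGenerated _ _

/-- The functor from countable strict pro-objects to locally linearly compact spaces of countable
type induced by `Λ`. -/
noncomputable def countableFunctor : CountableStrictProVect k ⥤ CountableLLCCat k :=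
  ObjectProperty.lift _ ((IsCountableStrictPro _).ι ⋙ Λ) fun X =>
    (hΛ.isLinearlyCompact X.obj).countableLLC (hΛ.isCountablyGenerated_nhds_zero X.property)

instance : (hΛ.countableFunctor ⋙ (countableLLCProp k).ι).Full :=
  inferInstanceAs (ObjectProperty.ιOfLE (isCountableStrictPro_le (FGModuleCat.{u} k)) ⋙
    hΛ.strictFunctor ⋙ (linearlyCompactProp k).ι).Full

instance : (hΛ.countableFunctor ⋙ (countableLLCProp k).ι).Faithful :=
  inferInstanceAs (ObjectProperty.ιOfLE (isCountableStrictPro_le (FGModuleCat.{u} k)) ⋙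
    hΛ.strictFunctor ⋙ (linearlyCompactProp k).ι).Faithful

instance : hΛ.countableFunctor.Full :=
  Functor.Full.of_comp_faithful _ (countableLLCProp k).ι

instance : hΛ.countableFunctor.Faithful :=
  Functor.Faithful.of_comp _ (countableLLCProp k).ι

theorem essImage_countableFunctor (V : CountableLLCCat k) :
    hΛ.countableFunctor.essImage V ↔ IsLinearlyCompact k V.obj := by
  constructor
  · rintro ⟨X, ⟨e⟩⟩
    exact (hΛ.isLinearlyCompact X.obj).of_continuousLinearEquiv
      ((countableLLCProp k).ι.mapIso e).toContinuousLinearEquiv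
  · intro hV
    have := hV.linear
    have := V.property.2.countable_nhds
    obtain ⟨W, hopen, hbasis⟩ :=
      (IsLinearTopology.hasBasis_open_submodule k (M := V.obj)).exists_antitone_subbasis
    have hbasis' : (𝓝 (0 : V.obj)).HasBasis (fun _ => True)
        fun n : ULift.{u} ℕ => (W n.down : Set V.obj) :=
      hbasis.1.to_hasBasis (fun n _ => ⟨⟨n⟩, trivial, subset_rfl⟩)
        fun n _ => ⟨n.down, trivial, subset_rfl⟩
    obtain ⟨F, hF, ⟨e⟩⟩ := hΛ.exists_epi_lim_iso hV (fun _ _ h => hbasis.2 h)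
      (fun n : ULift.{u} ℕ => hopen n.down) hbasis'
    exact ⟨⟨(ProObj.lim _ _).obj F, _, inferInstance, inferInstance, inferInstance, F, hF,
      ⟨Iso.refl _⟩⟩, ⟨(countableLLCProp k).isoMk e⟩⟩

end IsProjectiveLimitFunctor

end CountableProObjects

section IndConstant

variable {k : Type u} [Field k] [TopologicalSpace k]

namespace TateRealization

variable {X : AdmBiFun (FGModuleCat.{u} k)} {V : TopModuleCat.{u} k} (R : TateRealization X.obj V)
  (hX : IsIndConstant _ X)

include hX in
theorem mem_L_zero_of_isIndConstant (x : V) : x ∈ R.L 0 := by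
  obtain ⟨j, hj⟩ := R.isTateFiltration.exists_mem x
  have hj' : x ∈ R.L (max 0 j) := R.mono (le_max_right _ _) hj
  have hiso := hX 0 (max 0 j) le_rfl (le_max_left _ _)
  have hzero : ∀ y : X.obj.obj (TateIdx.mk 0 (max 0 j) (le_max_left _ _)), y = 0 :=
    ((fgModuleCat_epi_iff_surjective (X.obj.map (TateIdx.hom le_rfl
      (le_rfl.trans (le_max_left 0 j)) le_rfl (le_max_left 0 j)))).1 inferInstance).forall.2
      fun z => (congrArg _ (X.property.eq_zero rfl z)).trans (map_zero _)
  exact (R.proj_eq_zero_iff (TateIdx.mk 0 (max 0 j) (le_max_left _ _)) ⟨x, hj'⟩).1 (hzero _)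

/-- The projections `V → X_{-n,0}` of a realization of an ind-constant functor. -/
noncomputable def negProj (n : (ULift.{u} ℕ)ᵒᵖ) : V →ₗ[k] X.obj.obj (negIdx.obj n) :=
  R.proj (negIdx.obj n) ∘ₗ LinearMap.id.codRestrict (R.L 0) (R.mem_L_zero_of_isIndConstant hX)

theorem negProj_surjective (n : (ULift.{u} ℕ)ᵒᵖ) : Function.Surjective (R.negProj hX n) :=
  fun e => let ⟨x, hx⟩ := R.proj_surjective (negIdx.obj n) e; ⟨x, hx⟩

theorem ker_negProj (n : (ULift.{u} ℕ)ᵒᵖ) : (R.negProj hX n).ker = R.L (-(n.unop.down : ℤ)) :=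
  Submodule.ext fun x =>
    R.proj_eq_zero_iff (negIdx.obj n) ⟨x, R.mem_L_zero_of_isIndConstant hX x⟩

variable [DiscreteTopology k]

open discreteFunctor

/-- The cone of the projections `V → X_{-n,0}` of a realization of an ind-constant functor. -/
noncomputable def negCone : Cone ((negIdx ⋙ X.obj) ⋙ discreteFunctor k) where
  pt := V
  π :=
    { app := fun n => ofLin (R.negProj hX n)
        ((congrArg (fun W : Submodule k V => IsOpen (W : Set V)) (R.ker_negProj hX n)).mpr
          (R.isTateFiltration.isOpen _))
      naturality := fun _ b f => toLin_injective (X := V) (E := X.obj.obj (negIdx.obj b))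
        (LinearMap.ext fun x =>
          (R.map_proj (negIdx.map f) ⟨x, R.mem_L_zero_of_isIndConstant hX x⟩).symm) }

theorem nonempty_isLimit_negCone : Nonempty (IsLimit (R.negCone hX)) := by
  have htop : R.L 0 = ⊤ := eq_top_iff.2 fun x _ => R.mem_L_zero_of_isIndConstant hX x
  have hV : IsLinearlyCompact k V := (R.isLinearlyCompact 0).of_continuousLinearEquiv
    ((ContinuousLinearEquiv.ofEq _ _ htop).trans Submodule.topContEquiv)
  have hker (n : (ULift.{u} ℕ)ᵒᵖ) :
      (coneProj (R.negCone hX) n).ker = R.L (-(n.unop.down : ℤ)) := R.ker_negProj hX n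
  refine nonempty_isLimit_of_isLinearlyCompact _ hV (R.negProj_surjective hX)
    (R.isTateFiltration.hasBasis.to_hasBasis ?_ ?_)
  · refine fun j _ => ⟨op ⟨(-j).toNat⟩, trivial, (hker _).le.trans (R.mono ?_)⟩
    exact neg_le.2 (Int.self_le_toNat (-j))
  · exact fun n _ => ⟨_, trivial, (hker n).ge⟩

end TateRealization

variable [DiscreteTopology k]

open discreteFunctor

theorem indProLim.negProj_map {X Y : (IsIndConstant (FGModuleCat.{u} k)).FullSubcategory}
    (f : X ⟶ Y) (n : (ULift.{u} ℕ)ᵒᵖ) (x : (indProLim k).obj X.obj.obj) :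
    (indProLim.realization Y.obj.property).negProj Y.property n
        (((indProLim k).map f.hom.hom).hom x) =
      (f.hom.hom.app (negIdx.obj n)).hom.hom
        ((indProLim.realization X.obj.property).negProj X.property n x) :=
  (indProLim.compat_map X.obj.property Y.obj.property f.hom.hom x (negIdx.obj n)
    ((indProLim.realization X.obj.property).mem_L_zero_of_isIndConstant X.property x)).choose_spec

namespace IsProjectiveLimitFunctor

variable {Λ : ProObj (FGModuleCat.{u} k) ⥤ TopModuleCat.{u} k} (hΛ : IsProjectiveLimitFunctor k Λ)
  (X : (IsIndConstant (FGModuleCat.{u} k)).FullSubcategory)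

/-- On ind-constant functors, the projective limit of the `X_{i,0}` agrees with
`colim_j lim_i X_{ij}`. -/
noncomputable def indConstantIso :
    Λ.obj ((ProObj.lim _ _).obj (negIdx.{u} ⋙ X.obj.obj)) ≅ (indProLim k).obj X.obj.obj :=
  (hΛ.isLimit (negIdx.{u} ⋙ X.obj.obj)).conePointUniqueUpToIso
    ((indProLim.realization X.obj.property).nonempty_isLimit_negCone X.property).some

theorem negProj_indConstantIso_hom (n : (ULift.{u} ℕ)ᵒᵖ)
    (x : Λ.obj ((ProObj.lim _ _).obj (negIdx.{u} ⋙ X.obj.obj))) :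
    (indProLim.realization X.obj.property).negProj X.property n
      ((hΛ.indConstantIso X).hom.hom x) = hΛ.linearMap ((ProObj.cone _).π.app n) x :=
  congrArg (fun g => toLin (E := X.obj.obj.obj (negIdx.obj n)) g x)
    (IsLimit.conePointUniqueUpToIso_hom_comp (hΛ.isLimit (negIdx.{u} ⋙ X.obj.obj))
      ((indProLim.realization X.obj.property).nonempty_isLimit_negCone X.property).some n)

variable {X} {Y : (IsIndConstant (FGModuleCat.{u} k)).FullSubcategory}

theorem indConstantIso_naturality (f : X ⟶ Y) :
    Λ.map ((ProObj.lim _ _).map (Functor.whiskerLeft negIdx.{u} f.hom.hom)) ≫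
      (hΛ.indConstantIso Y).hom = (hΛ.indConstantIso X).hom ≫ (indProLim k).map f.hom.hom := by
  let g := Functor.whiskerLeft negIdx.{u} f.hom.hom
  let S := indProLim.realization Y.obj.property
  refine (S.nonempty_isLimit_negCone Y.property).some.hom_ext fun n =>
    toLin_injective (LinearMap.ext fun x => ?_)
  calc S.negProj Y.property n
        ((hΛ.indConstantIso Y).hom.hom ((Λ.map ((ProObj.lim _ _).map g)).hom x))
    _ = hΛ.linearMap ((ProObj.cone _).π.app n) ((Λ.map ((ProObj.lim _ _).map g)).hom x) :=
      hΛ.negProj_indConstantIso_hom Y n _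
    _ = hΛ.linearMap ((ProObj.lim _ _).map g ≫ (ProObj.cone _).π.app n) x :=
      (hΛ.linearMap_comp _ _ x).symm
    _ = hΛ.linearMap ((ProObj.cone _).π.app n ≫ (ProObj.const _).map (g.app n)) x :=
      congrArg (fun h => hΛ.linearMap h x) (ProObj.lim_map_cone_π g n)
    _ = (g.app n).hom.hom (hΛ.linearMap ((ProObj.cone _).π.app n) x) :=
      hΛ.linearMap_comp_const _ _ _
    _ = S.negProj Y.property n
        (((indProLim k).map f.hom.hom).hom ((hΛ.indConstantIso X).hom.hom x)) :=
      (congrArg _ (hΛ.negProj_indConstantIso_hom X n x).symm).trans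
        (indProLim.negProj_map f n _).symm

/-- On ind-constant functors, the projective limit functor agrees with `admLim`. -/
noncomputable def indConstantNatIso :
    indConstantToPro (FGModuleCat.{u} k) ⋙ hΛ.countableFunctor ≅
      (IsIndConstant (FGModuleCat.{u} k)).ι ⋙ admLim :=
  NatIso.ofComponents (fun X => (countableLLCProp k).isoMk (hΛ.indConstantIso X))
    fun f => ObjectProperty.hom_ext _ (hΛ.indConstantIso_naturality f)

/-- The embedding of countable strict pro-objects into Tate spaces. -/
noncomputable def toTate : CountableStrictProVect k ⥤ TateCat k :=
  hΛ.countableFunctor ⋙ tateLim.inv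

instance : hΛ.toTate.Full := inferInstanceAs (hΛ.countableFunctor ⋙ tateLim.inv).Full

instance : hΛ.toTate.Faithful := inferInstanceAs (hΛ.countableFunctor ⋙ tateLim.inv).Faithful

/-- The projective limit functor factors through Tate spaces on countable strict pro-objects. -/
noncomputable def toTateCompTateLim : hΛ.toTate ⋙ tateLim ≅ hΛ.countableFunctor :=
  Functor.isoWhiskerLeft hΛ.countableFunctor tateLim.asEquivalence.counitIso ≪≫
    Functor.rightUnitor _

/-- `toTate` sends `"lim" X_{i,0}` to `X`, for every ind-constant functor `X`. -/
noncomputable def indConstantToProCompToTate :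
    indConstantToPro (FGModuleCat.{u} k) ⋙ hΛ.toTate ≅
      (IsIndConstant (FGModuleCat.{u} k)).ι ⋙ (beilinsonU (FGModuleCat.{u} k)).Q :=
  calc indConstantToPro (FGModuleCat.{u} k) ⋙ hΛ.toTate
    _ ≅ ((IsIndConstant (FGModuleCat.{u} k)).ι ⋙ admLim) ⋙ tateLim.inv :=
      Functor.isoWhiskerRight hΛ.indConstantNatIso tateLim.inv
    _ ≅ ((IsIndConstant (FGModuleCat.{u} k)).ι ⋙ (beilinsonU _).Q ⋙ tateLim) ⋙ tateLim.inv :=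
      Functor.isoWhiskerRight (Functor.isoWhiskerLeft _ tateLimIso.symm) tateLim.inv
    _ ≅ (IsIndConstant (FGModuleCat.{u} k)).ι ⋙ (beilinsonU _).Q :=
      Functor.isoWhiskerLeft ((IsIndConstant (FGModuleCat.{u} k)).ι ⋙ (beilinsonU _).Q)
        tateLim.asEquivalence.unitIso.symm ≪≫ Functor.rightUnitor _

end IsProjectiveLimitFunctor

end IndConstant

theorem mainTheorem8 (k : Type u) [Field k] [TopologicalSpace k] [DiscreteTopology k] :
    ∃ (Φ : TateCat k ⥤ CountableLLCCat k)
      (Λ : ProObj (FGModuleCat.{u} k) ⥤ TopModuleCat.{u} k)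
      (Φ₀ : StrictProVect k ⥤ LinearlyCompactCat k)
      (E : CountableStrictProVect k ⥤ TateCat k),
      -- `Φ` is induced by `(V_{ij}) ↦ colim_j lim_i V_{ij}` and is an equivalence
      Nonempty ((beilinsonU (FGModuleCat.{u} k)).Q ⋙ Φ ⋙ (countableLLCProp k).ι ≅
        (IsAdmissibleBiFun (FGModuleCat.{u} k)).ι ⋙ indProLim k) ∧
      Φ.IsEquivalence ∧
      -- `Φ₀` is given by `"lim" V_j ↦ lim V_j` and is an equivalence
      IsProjectiveLimitFunctor k Λ ∧
      Nonempty (Φ₀ ⋙ (linearlyCompactProp k).ι ≅ (IsStrictPro (FGModuleCat.{u} k)).ι ⋙ Λ) ∧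
      Φ₀.IsEquivalence ∧
      -- `E` is the embedding of countable strict pro-objects into `𝓣`
      E.Full ∧ E.Faithful ∧
      Nonempty (indConstantToPro (FGModuleCat.{u} k) ⋙ E ≅
        (IsIndConstant (FGModuleCat.{u} k)).ι ⋙ (beilinsonU (FGModuleCat.{u} k)).Q) ∧
      -- the restriction of `Φ` along `E` is `Φ₀`
      Nonempty (E ⋙ Φ ⋙ (countableLLCProp k).ι ≅
        ObjectProperty.ιOfLE (isCountableStrictPro_le (FGModuleCat.{u} k)) ⋙ Φ₀ ⋙
          (linearlyCompactProp k).ι) ∧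
      -- and its essential image consists of the linearly compact spaces
      (∀ V : CountableLLCCat k, (E ⋙ Φ).essImage V ↔ IsLinearlyCompact k V.obj) := by
  obtain ⟨Λ, hΛ⟩ := exists_isProjectiveLimitFunctor (k := k)
  refine ⟨tateLim, Λ, hΛ.strictFunctor, hΛ.toTate,
    ⟨Functor.isoWhiskerRight tateLimIso (countableLLCProp k).ι⟩, inferInstance, hΛ,
    ⟨Iso.refl _⟩, inferInstance, inferInstance, inferInstance, ⟨hΛ.indConstantToProCompToTate⟩,
    ⟨Functor.isoWhiskerRight hΛ.toTateCompTateLim (countableLLCProp k).ι⟩, fun V => ?_⟩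
  rw [← hΛ.essImage_countableFunctor, Functor.essImage_eq_of_natIso hΛ.toTateCompTateLim]
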